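/- Let $m,n\ge 1$. For real $m\times n$ matrices $A,B$, a Nash equilibrium of the bimatrix game $(A,B)$ is a pair $(x,y)\in\Delta_1\times\Delta_2$ of mixed strategies ($\Delta_1\subset\mathbb R^m$, $\Delta_2\subset\mathbb R^n$ the standard simplices) with $x^TAy\ge x'^TAy$ for all $x'\in\Delta_1$ and $x^TBy\ge x^TBy'$ for all $y'\in\Delta_2$. Put $$P=\{(y,\pi_1)\in\Delta_2\times\mathbb R : A_iy\le\pi_1\ (1\le i\le m)\},\qquad Q=\{(x,\pi_2)\in\Delta_1\times\mathbb R : x^TB^j\le\pi_2\ (1\le j\le n)\},$$ where $A_i$ is the $i$-th row of $A$ and $B^j$ the $j$-th column of $B$; and for a real $m\times n$ matrix $C$ and $\beta\in\mathbb R^n$ put $$Q'=\{(x,\lambda,\pi_2)\in\Delta_1\times\mathbb R^2 : x^TC^j+\beta_j\lambda\le\pi_2\ (1\le j\le n)\}.$$ The label set $L(v)\subseteq\{1,\dots,m+n\}$ of a point $v$ of one of these polyhedra is the set of its tight inequalities: in $P$, label $i\le m$ means $A_iy=\pi_1$ and label $m+j$ means $y_j=0$; in $Q$ and $Q'$, label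 $i\le m$ means $x_i=0$ and label $m+j$ means that the $j$-th payoff inequality is tight. $P$, $Q$, $Q'$ are called non-degenerate if each of their points has at most $n$, $m$, $m+1$ labels respectively, and the game $(A,B)$ is non-degenerate if $P$ and $Q$ are. For $\alpha\in\mathbb R^m$ let $G(\alpha)=(A,\,C+\alpha\beta^T)$, let $\Gamma=\{G(\alpha):\alpha\in\mathbb R^m\}$, and let $$\mathcal N=\{(v,w)\in P\times Q' : L(v)\cup L(w)=\{1,\dots,m+n\}\},\qquad H_\alpha=\Big\{\big((y,\pi_1),(x,\lambda,\pi_2)\big) : \lambda-\sum_{i=1}^m\alpha_ix_i=0\Big\}.$$ (1) Suppose that $P$ and $Q'$ are non-degenerate and that the minimum of the entries of $\beta$ is attained at a single index, and so is the maximum. Then exactly one connected component $\mathcal P$ of $\mathcal N$ is a simple path on the $1$-skeleton of $P\times Q'$ that is unbounded at both ends (a single edge which is a whole line being allowed), and the other components are finitely many simple cycles on the $1$-skeleton. $\mathcal P$ is called the fully-labeled path. It contains at least one Nash equilibrium of every game in $\Gamma$: for every $\alpha\in\mathbb R^m$ there is a point $\big((y,\pi_1),(x,\lambda,\pi_2)\big)\in\mathcal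 P\cap H_\alpha$ such that $(x,y)$ is a Nash equilibrium of $G(\alpha)$. If moreover $G(\alpha)$ is non-degenerate, then $H_\alpha$ meets $\mathcal P$ in a finite odd number of points and meets every cycle of $\mathcal N$ in a finite even number of points. (2) Every bimatrix game has a Nash equilibrium. (3) Every non-degenerate bimatrix game has a finite and odd number of Nash equilibria. -/

import Mathlib

open scoped Matrix

noncomputable section

namespace BimatrixGame

variable {m n : ℕ}

/-- `(x, y)` is a Nash equilibrium strategy profile of the bimatrix game `(A, B)`. -/
def IsNash (A B : Matrix (Fin m) (Fin n) ℝ) (x : Fin m → ℝ) (y : Fin n → ℝ) : Prop :=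
  x ∈ stdSimplex ℝ (Fin m) ∧ y ∈ stdSimplex ℝ (Fin n) ∧
    (∀ x' ∈ stdSimplex ℝ (Fin m), x' ⬝ᵥ (A *ᵥ y) ≤ x ⬝ᵥ (A *ᵥ y)) ∧
    (∀ y' ∈ stdSimplex ℝ (Fin n), x ⬝ᵥ (B *ᵥ y') ≤ x ⬝ᵥ (B *ᵥ y))

/-- The set of Nash equilibrium strategy profiles of the bimatrix game `(A, B)`. -/
def nashSet (A B : Matrix (Fin m) (Fin n) ℝ) : Set ((Fin m → ℝ) × (Fin n → ℝ)) :=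
  {s | IsNash A B s.1 s.2}

/-- The best response polyhedron `P` of the row player, with points `(y, π₁)`. -/
def polyP (A : Matrix (Fin m) (Fin n) ℝ) : Set ((Fin n → ℝ) × ℝ) :=
  {v | v.1 ∈ stdSimplex ℝ (Fin n) ∧ ∀ i, (A *ᵥ v.1) i ≤ v.2}

/-- The best response polyhedron `Q` of the column player, with points `(x, π₂)`. -/
def polyQ (B : Matrix (Fin m) (Fin n) ℝ) : Set ((Fin m → ℝ) × ℝ) :=
  {w | w.1 ∈ stdSimplex ℝ (Fin m) ∧ ∀ j, (w.1 ᵥ* B) j ≤ w.2}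

/-- The polyhedron `Q'` of the game space, with points `(x, λ, π₂)`. -/
def polyQ' (C : Matrix (Fin m) (Fin n) ℝ) (β : Fin n → ℝ) : Set ((Fin m → ℝ) × ℝ × ℝ) :=
  {w | w.1 ∈ stdSimplex ℝ (Fin m) ∧ ∀ j, (w.1 ᵥ* C) j + β j * w.2.1 ≤ w.2.2}

/-- The labels of `(y, π₁)`, i.e. the indices of the tight inequalities of `P`.  The label `inl i`
stands for the row `i`, the label `inr j` for the column `j`. -/
def labelP (A : Matrix (Fin m) (Fin n) ℝ) (v : (Fin n → ℝ) × ℝ) : Set (Fin m ⊕ Fin n) :=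
  {l | Sum.elim (fun i => (A *ᵥ v.1) i = v.2) (fun j => v.1 j = 0) l}

/-- The labels of `(x, π₂)`, i.e. the indices of the tight inequalities of `Q`. -/
def labelQ (B : Matrix (Fin m) (Fin n) ℝ) (w : (Fin m → ℝ) × ℝ) : Set (Fin m ⊕ Fin n) :=
  {l | Sum.elim (fun i => w.1 i = 0) (fun j => (w.1 ᵥ* B) j = w.2) l}

/-- The labels of `(x, λ, π₂)`, i.e. the indices of the tight inequalities of `Q'`. -/
def labelQ' (C : Matrix (Fin m) (Fin n) ℝ) (β : Fin n → ℝ) (w : (Fin m → ℝ) × ℝ × ℝ) :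
    Set (Fin m ⊕ Fin n) :=
  {l | Sum.elim (fun i => w.1 i = 0) (fun j => (w.1 ᵥ* C) j + β j * w.2.1 = w.2.2) l}

/-- `P` (of dimension `n`) is non-degenerate: at most `n` inequalities are tight at any point. -/
def NondegP (A : Matrix (Fin m) (Fin n) ℝ) : Prop :=
  ∀ v ∈ polyP A, (labelP A v).ncard ≤ n

/-- `Q` (of dimension `m`) is non-degenerate: at most `m` inequalities are tight at any point. -/
def NondegQ (B : Matrix (Fin m) (Fin n) ℝ) : Prop :=
  ∀ w ∈ polyQ B, (labelQ B w).ncard ≤ m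

/-- `Q'` (of dimension `m + 1`) is non-degenerate: at most `m + 1` inequalities are tight at any
point. -/
def NondegQ' (C : Matrix (Fin m) (Fin n) ℝ) (β : Fin n → ℝ) : Prop :=
  ∀ w ∈ polyQ' C β, (labelQ' C β w).ncard ≤ m + 1

/-- The bimatrix game `(A, B)` is non-degenerate. -/
def NondegGame (A B : Matrix (Fin m) (Fin n) ℝ) : Prop :=
  NondegP A ∧ NondegQ B

/-- The space of points `((y, π₁), (x, λ, π₂))`. -/
abbrev Pt (m n : ℕ) : Type := ((Fin n → ℝ) × ℝ) × ((Fin m → ℝ) × ℝ × ℝ)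

/-- The set `N` of fully-labeled pairs of `P × Q'`. -/
def fullyLabeled (A C : Matrix (Fin m) (Fin n) ℝ) (β : Fin n → ℝ) : Set (Pt m n) :=
  {p | p ∈ polyP A ×ˢ polyQ' C β ∧ labelP A p.1 ∪ labelQ' C β p.2 = Set.univ}

/-- The column player's payoff matrix `C + α βᵀ` in the game `G(α)`. -/
def payoff (C : Matrix (Fin m) (Fin n) ℝ) (β : Fin n → ℝ) (α : Fin m → ℝ) :
    Matrix (Fin m) (Fin n) ℝ :=
  C + Matrix.vecMulVec α β

/-- The hyperplane `H : λ - ∑ i, α i * x i = 0` attached to `G(α)`. -/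
def hyperplane (m n : ℕ) (α : Fin m → ℝ) : Set (Pt m n) :=
  {p | p.2.2.1 - ∑ i, α i * p.2.1 i = 0}

section Skeleton

variable {E : Type*} [AddCommGroup E] [Module ℝ E]

/-- `e` is an edge, i.e. a one-dimensional face, of the polyhedron `K`; it may be unbounded. -/
def IsEdge (K e : Set E) : Prop :=
  IsExtreme ℝ K e ∧ Convex ℝ e ∧ Module.finrank ℝ (vectorSpan ℝ e) = 1

/-- The closed half-line from `p` in direction `d`. -/
def ray (p d : E) : Set E := {q | ∃ t : ℝ, 0 ≤ t ∧ q = p + t • d}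

/-- The line through `p` in direction `d`. -/
def line (p d : E) : Set E := {q | ∃ t : ℝ, q = p + t • d}

/-- `S` is a simple cycle on the 1-skeleton of the polyhedron `K`: the union of the edges joining
cyclically consecutive members of a list of at least three distinct vertices of `K`.  (Indices in
`Fin (k + 3)` are added modulo `k + 3`.  Distinct edges of a polyhedron meet at most in a common
vertex.) -/
def IsEdgeCycle (K S : Set E) : Prop :=
  ∃ (k : ℕ) (p : Fin (k + 3) → E), Function.Injective p ∧
    (∀ i, p i ∈ K.extremePoints ℝ) ∧
    (∀ i, IsEdge K (segment ℝ (p i) (p (i + 1)))) ∧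
    S = ⋃ i, segment ℝ (p i) (p (i + 1))

/-- `S` is a simple path on the 1-skeleton of the polyhedron `K` which is unbounded at both ends:
two distinct unbounded edges, starting in the first and in the last member of a nonempty list of
distinct vertices of `K`, together with the edges joining consecutive members of this list; or,
without any vertex, one edge which is a whole line. -/
def IsEdgePath (K S : Set E) : Prop :=
  (∃ (k : ℕ) (p : Fin (k + 1) → E) (d d' : E), Function.Injective p ∧
    (∀ i, p i ∈ K.extremePoints ℝ) ∧
    (∀ i : Fin k, IsEdge K (segment ℝ (p i.castSucc) (p i.succ))) ∧
    IsEdge K (ray (p 0) d) ∧ IsEdge K (ray (p (Fin.last k)) d') ∧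
    ray (p 0) d ≠ ray (p (Fin.last k)) d' ∧
    S = ray (p 0) d ∪ (⋃ i : Fin k, segment ℝ (p i.castSucc) (p i.succ)) ∪
      ray (p (Fin.last k)) d') ∨
  (∃ p d : E, IsEdge K (line p d) ∧ S = line p d)

end Skeleton

/-- `S` is a connected component of the set `N` of fully-labeled pairs. -/
def IsComponent (A C : Matrix (Fin m) (Fin n) ℝ) (β : Fin n → ℝ) (S : Set (Pt m n)) : Prop :=
  ∃ p ∈ fullyLabeled A C β, S = connectedComponentIn (fullyLabeled A C β) p

/-- `S` is a fully-labeled path: a component of `N` which is a path on the 1-skeleton of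
`P × Q'`. -/
def IsFullyLabeledPath (A C : Matrix (Fin m) (Fin n) ℝ) (β : Fin n → ℝ) (S : Set (Pt m n)) :
    Prop :=
  IsComponent A C β S ∧ IsEdgePath (polyP A ×ˢ polyQ' C β) S

/-- `S` is a cycle of `N`: a component of `N` which is a cycle on the 1-skeleton of `P × Q'`. -/
def IsFullyLabeledCycle (A C : Matrix (Fin m) (Fin n) ℝ) (β : Fin n → ℝ) (S : Set (Pt m n)) :
    Prop :=
  IsComponent A C β S ∧ IsEdgeCycle (polyP A ×ˢ polyQ' C β) S

end BimatrixGame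

end

/-! Every label names one inequality of P and one of Q'. A fully-labeled point satisfies, for some
choice `c` of one of the two for each label, all the chosen inequalities with equality, so N is the
union of the faces `face c` of P × Q'. The dimension is m + n + 1 and there are m + n labels; by
non-degeneracy a nonempty face is an edge, possibly unbounded, and at each of its ends exactly one
label is tight twice. Exchanging the choice for that label gives the only other edge of N at this
vertex. Hence N is a graph of degree two, a union of paths and cycles. The ends of edges are the
elements of `Dart`, with two involutions: `flip` changes the edge at a vertex and has no fixed
point, `opp` passes to the other end of the edge and fixes exactly the ends of rays.

Along a ray only λ and π₂ move. For λ → ∞ the column player must play the maximum of β, for λ → -∞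
the minimum, and the row player the unique best reply to it. So there is one ray for each sign of λ,
hence exactly one path (`ray_direction`, `exists_ray_dart`, `decomposition_of_two_rays`). If n = 1,
then P × Q' contains a line and N is a line.

The points of N on H_α are the equilibria of G(α) (`nashSet_eq_image`). The functional λ - ∑ αᵢxᵢ,
called `gap`, has opposite signs far out on the two rays, so it vanishes somewhere on the connected
path. If G(α) is non-degenerate, no vertex of N lies on H_α, and pairing the darts with a positive
vertex by `flip` and `opp` gives the parities (`odd_ncard_orbit_inter`, `even_ncard_orbit_inter`).

Oddness for a single game (A, B) follows with C = B, α = 0 and a generic β. Existence follows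
because non-degenerate games are dense and the games with an equilibrium form a closed set. -/

noncomputable section

namespace BimatrixGame

set_option linter.unusedSectionVars false

/-! ### Simple polyhedra with complementary pairs of inequalities -/

/-- A polyhedron `{p | ψ p = w, φ t p ≥ 0}` whose inequalities come in complementary pairs, indexed
by the labels `l : L`. -/
structure PairedSystem (L E W : Type*) [AddCommGroup E] [Module ℝ E] [AddCommGroup W]
    [Module ℝ W] where
  φ : L × Bool → E →ₗ[ℝ] ℝ
  ψ : E →ₗ[ℝ] W
  w : W

namespace PairedSystem

variable {L E W : Type*} [AddCommGroup E] [Module ℝ E] [AddCommGroup W] [Module ℝ W]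
  (M : PairedSystem L E W)

/-- The polyhedron of a paired system. -/
def poly : Set E := {p | M.ψ p = M.w ∧ ∀ t, 0 ≤ M.φ t p}

/-- The face on which, for every label `l`, the inequality `(l, c l)` is tight. -/
def face (c : L → Bool) : Set E := {p | p ∈ M.poly ∧ ∀ l, M.φ (l, c l) p = 0}

/-- The set of fully labeled points. -/
def full : Set E := {p | p ∈ M.poly ∧ ∀ l, ∃ s, M.φ (l, s) p = 0}

/-- `v` is a vertex of the face of `c`, with both inequalities of the label `l` tight. -/
def IsDart (c : L → Bool) (l : L) (v : E) : Prop := v ∈ M.face c ∧ M.φ (l, !c l) v = 0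

theorem full_eq_iUnion : M.full = ⋃ c, M.face c := by
  ext p
  simp only [full, face, Set.mem_ofPred_eq, Set.mem_iUnion]
  constructor
  · rintro ⟨h, h'⟩
    choose c hc using h'
    exact ⟨c, h, hc⟩
  · rintro ⟨c, h, hc⟩
    exact ⟨h, fun l => ⟨c l, hc l⟩⟩

theorem convex_face (c : L → Bool) : Convex ℝ (M.face c) := by
  intro x hx y hy a b ha hb hab
  refine ⟨⟨?_, fun t => ?_⟩, fun l => ?_⟩
  · rw [map_add, map_smul, map_smul, hx.1.1, hy.1.1, ← add_smul, hab, one_smul]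
  · rw [map_add, map_smul, map_smul]
    exact add_nonneg (smul_nonneg ha (hx.1.2 t)) (smul_nonneg hb (hy.1.2 t))
  · rw [map_add, map_smul, map_smul, hx.2, hy.2]; simp

theorem eq_zero_of_mem_openSegment {t : L × Bool} {x y z : E} (hx : x ∈ M.poly) (hy : y ∈ M.poly)
    (hz : z ∈ openSegment ℝ x y) (h : M.φ t z = 0) : M.φ t x = 0 := by
  obtain ⟨a, b, ha, hb, -, rfl⟩ := hz
  have h1 := hx.2 t
  have h2 := hy.2 t
  simp only [map_add, map_smul, smul_eq_mul] at h
  have h3 := mul_nonneg ha.le h1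
  have h4 := mul_nonneg hb.le h2
  have : a * M.φ t x = 0 := by linarith
  exact (mul_eq_zero.1 this).resolve_left ha.ne'

theorem isExtreme_face (c : L → Bool) : IsExtreme ℝ M.poly (M.face c) := by
  refine ⟨fun p hp => hp.1, ?_⟩
  intro x hx y hy z hz hzs
  exact ⟨hx, fun l => M.eq_zero_of_mem_openSegment hx hy hzs (hz.2 l)⟩

/-- The polyhedron is line-free and simple, of dimension one more than the number of labels. -/
structure Regular [Fintype L] : Prop where
  pointed : ∀ u, M.ψ u = 0 → (∀ t, M.φ t u = 0) → u = 0
  finrank_ker : Module.finrank ℝ (LinearMap.ker M.ψ) = Fintype.card L + 1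
  card_tight_le : ∀ p ∈ M.poly, {t | M.φ t p = 0}.ncard ≤ Fintype.card L + 1

variable {M}

/-- The ratio test of the simplex method: among the inequalities that decrease along `u`, the one
that becomes tight first stops the motion. -/
theorem exists_min_ratio [Finite L] {q u : E} (hq : q ∈ M.poly) (hu : M.ψ u = 0)
    (h : ∃ t, M.φ t u < 0) :
    ∃ a : ℝ, 0 ≤ a ∧ ∃ t, q + a • u ∈ M.poly ∧ M.φ t u < 0 ∧ M.φ t (q + a • u) = 0 := by
  classical
  have := Fintype.ofFinite L
  obtain ⟨t, ht, hmin⟩ := Finset.exists_min_image (Finset.univ.filter fun t => M.φ t u < 0)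
    (fun t => M.φ t q / (- M.φ t u)) (by obtain ⟨t, ht⟩ := h; exact ⟨t, by simpa using ht⟩)
  simp only [Finset.mem_filter, Finset.mem_univ, true_and] at ht hmin
  have ha : 0 ≤ M.φ t q / (- M.φ t u) := div_nonneg (hq.2 t) (by linarith)
  refine ⟨M.φ t q / (- M.φ t u), ha, t, ⟨?_, fun t' => ?_⟩, ht, ?_⟩
  · rw [map_add, map_smul, hu, smul_zero, add_zero, hq.1]
  · rw [map_add, map_smul, smul_eq_mul]
    rcases lt_or_ge (M.φ t' u) 0 with h' | h'
    · have h1 := hmin t' h'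
      rw [le_div_iff₀ (by linarith)] at h1
      linarith
    · exact add_nonneg (hq.2 t') (mul_nonneg ha h')
  · rw [map_add, map_smul, smul_eq_mul]
    field_simp [ht.ne]
    ring

theorem exists_lt_zero_of_ne_zero [Fintype L] (hM : M.Regular) {u : E} (hu : M.ψ u = 0)
    (h : u ≠ 0) (T : Set (L × Bool)) (hT : ∀ t ∈ T, M.φ t u = 0) :
    ∃ u', M.ψ u' = 0 ∧ (∀ t ∈ T, M.φ t u' = 0) ∧ ∃ t, M.φ t u' < 0 := by
  by_contra! hc
  refine h (hM.pointed u hu fun t => ?_)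
  have h1 := hc u hu hT t
  have h2 := hc (-u) (by simp [hu]) (fun t ht => by simp [hT t ht]) t
  rw [map_neg] at h2
  linarith

variable (M) in
/-- The tight inequalities at `p`, evaluated on the tangent space. -/
def tightMap (p : E) : LinearMap.ker M.ψ →ₗ[ℝ] ({t // M.φ t p = 0} → ℝ) :=
  LinearMap.pi fun t => M.φ t.1 ∘ₗ (LinearMap.ker M.ψ).subtype

/-- From `p` one moves along directions that keep the tight inequalities tight until another one
becomes tight. Their number is bounded, so a point with the maximal number exists, and there no such
direction is left: it is a vertex. -/
theorem exists_ker_tightMap_eq_bot [Fintype L] (hM : M.Regular) {p : E} (hp : p ∈ M.poly) :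
    ∃ q ∈ M.poly, (∀ t, M.φ t p = 0 → M.φ t q = 0) ∧ LinearMap.ker (M.tightMap q) = ⊥ := by
  classical
  obtain ⟨k, ⟨q, ⟨hq, hpq⟩, hk⟩, hmax⟩ := Set.Finite.exists_maximal
    (s := (fun q => {t | M.φ t q = 0}.ncard) '' {q | q ∈ M.poly ∧ ∀ t, M.φ t p = 0 → M.φ t q = 0})
    (Set.Finite.subset (Set.finite_le_nat (Fintype.card L + 1)) (by
      rintro _ ⟨q, hq, rfl⟩
      exact hM.card_tight_le q hq.1)) ⟨_, p, ⟨hp, fun _ h => h⟩, rfl⟩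
  refine ⟨q, hq, hpq, ?_⟩
  rw [LinearMap.ker_eq_bot']
  rintro ⟨u, hu⟩ hu0
  by_contra hne
  have hu' : ∀ t ∈ {t | M.φ t q = 0}, M.φ t u = 0 := fun t ht => congrFun hu0 ⟨t, ht⟩
  obtain ⟨u, hψ, hT, hlt⟩ := exists_lt_zero_of_ne_zero hM hu (by simpa using hne) _ hu'
  obtain ⟨a, ha, t, hmem, htu, ht⟩ := exists_min_ratio hq hψ hlt
  have hsub : {t | M.φ t q = 0} ⊆ {t | M.φ t (q + a • u) = 0} := by
    intro t ht
    have := hT t ht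
    simp only [Set.mem_ofPred_eq] at ht ⊢
    simp [ht, this]
  have h1 : {t | M.φ t q = 0}.ncard < {t | M.φ t (q + a • u) = 0}.ncard := by
    refine Set.ncard_lt_ncard (Set.ssubset_iff_subset_ne.2 ⟨hsub, fun h => ?_⟩)
    have : t ∈ {t | M.φ t q = 0} := by rw [h]; exact ht
    exact htu.ne (hT t this)
  have h2 := hmax (y := {t | M.φ t (q + a • u) = 0}.ncard)
    ⟨q + a • u, ⟨hmem, fun t ht => hsub (hpq t ht)⟩, rfl⟩ (by rw [← hk]; exact h1.le)
  simp only at hk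
  omega

/-- At the vertex `q` the tight functionals are jointly injective on a space of dimension `card L +
1` and are at most that many, so they form a basis of its dual. The functionals tight at `p` are
among them, and `u` comes from the dual basis. -/
theorem exists_dual [Fintype L] (hM : M.Regular) {p : E} (hp : p ∈ M.poly) {t : L × Bool}
    (ht : M.φ t p = 0) :
    ∃ u, M.ψ u = 0 ∧ M.φ t u = 1 ∧ ∀ t', M.φ t' p = 0 → t' ≠ t → M.φ t' u = 0 := by
  classical
  obtain ⟨q, hq, hpq, hker⟩ := exists_ker_tightMap_eq_bot hM hp
  have hfin : Module.Finite ℝ (LinearMap.ker M.ψ) :=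
    Module.finite_of_finrank_pos (by rw [hM.finrank_ker]; omega)
  have hle := LinearMap.finrank_le_finrank_of_injective (LinearMap.ker_eq_bot.1 hker)
  have hcard := hM.card_tight_le q hq
  have hc : Module.finrank ℝ ({t // M.φ t q = 0} → ℝ) = {t | M.φ t q = 0}.ncard := by
    rw [Module.finrank_fintype_fun_eq_card, ← Nat.card_coe_set_eq, Nat.card_eq_fintype_card]
    rfl
  have hsurj : Function.Surjective (M.tightMap q) := by
    rw [← LinearMap.injective_iff_surjective_of_finrank_eq_finrank]
    · exact LinearMap.ker_eq_bot.1 hker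
    · have := hM.finrank_ker; omega
  obtain ⟨⟨u, hu⟩, h⟩ := hsurj (Pi.single ⟨t, hpq t ht⟩ 1)
  refine ⟨u, hu, ?_, fun t' ht' hne => ?_⟩
  · simpa [tightMap] using congrFun h ⟨t, hpq t ht⟩
  · have := congrFun h ⟨t', hpq t' ht'⟩
    rw [Pi.single_eq_of_ne (by simpa using hne)] at this
    simpa [tightMap] using this

theorem eq_zero_of_card_tight [Fintype L] (hM : M.Regular) {p : E} (hp : p ∈ M.poly)
    (hcard : Fintype.card L + 1 ≤ {t | M.φ t p = 0}.ncard) {u : E} (hu : M.ψ u = 0)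
    (h : ∀ t, M.φ t p = 0 → M.φ t u = 0) : u = 0 := by
  obtain ⟨q, hq, hpq, hker⟩ := exists_ker_tightMap_eq_bot hM hp
  have heq : {t | M.φ t p = 0} = {t | M.φ t q = 0} :=
    Set.eq_of_subset_of_ncard_le hpq ((hM.card_tight_le q hq).trans hcard)
  have : (⟨u, hu⟩ : LinearMap.ker M.ψ) = 0 := by
    rw [LinearMap.ker_eq_bot'] at hker
    refine hker _ ?_
    ext t
    have ht : t.1 ∈ {t | M.φ t p = 0} := by rw [heq]; exact t.2
    exact h t.1 ht
  exact congrArg Subtype.val this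

section Dart

variable [Fintype L] (hM : M.Regular)

theorem ncard_graph (c : L → Bool) : (Set.range fun l => (l, c l)).ncard = Fintype.card L := by
  rw [← Set.image_univ, Set.ncard_image_of_injective _ (fun a b h => (Prod.ext_iff.1 h).1),
    Set.ncard_univ, Nat.card_eq_fintype_card]

theorem ncard_insert_graph (c : L → Bool) (l : L) :
    (insert (l, !c l) (Set.range fun l => (l, c l))).ncard = Fintype.card L + 1 := by
  rw [Set.ncard_insert_of_notMem, ncard_graph]
  rintro ⟨l', h⟩
  simp only [Prod.mk.injEq] at h
  obtain ⟨rfl, h⟩ := h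
  simp at h

variable {c c' : L → Bool} {l l' : L} {v v' q : E}

include hM in
-- The choice `c` and the doubled label already account for the maximal number `card L + 1` of tight
-- inequalities.
theorem IsDart.tight_eq (h : M.IsDart c l v) :
    {t | M.φ t v = 0} = insert (l, !c l) (Set.range fun l => (l, c l)) := by
  symm
  refine Set.eq_of_subset_of_ncard_le ?_ ?_
  · rintro t (rfl | ⟨l, rfl⟩)
    · exact h.2
    · exact h.1.2 l
  · rw [ncard_insert_graph]
    exact hM.card_tight_le v h.1.1

include hM in
theorem IsDart.label_eq (h : M.IsDart c l v) (h' : M.φ (l', !c l') v = 0) : l' = l := by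
  have : (l', !c l') ∈ {t | M.φ t v = 0} := h'
  rw [h.tight_eq hM] at this
  rcases this with h | ⟨l'', h⟩
  · exact (Prod.ext_iff.1 h).1
  · simp only [Prod.mk.injEq] at h
    obtain ⟨rfl, h⟩ := h
    simp at h

include hM in
theorem IsDart.eq_zero (h : M.IsDart c l v) {u : E} (hu : M.ψ u = 0)
    (h1 : ∀ l', M.φ (l', c l') u = 0) (h2 : M.φ (l, !c l) u = 0) : u = 0 := by
  refine eq_zero_of_card_tight hM h.1.1 ?_ hu fun t ht => ?_
  · rw [h.tight_eq hM, ncard_insert_graph]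
  · have : t ∈ {t | M.φ t v = 0} := ht
    rw [h.tight_eq hM] at this
    rcases this with rfl | ⟨l'', rfl⟩
    · exact h2
    · exact h1 _

include hM in
-- The inequality `(l, !c l)` serves as a coordinate on the face, with origin `v` and nonnegative
-- values.
theorem IsDart.exists_dir (h : M.IsDart c l v) :
    ∃ u, M.ψ u = 0 ∧ M.φ (l, !c l) u = 1 ∧ (∀ l', M.φ (l', c l') u = 0) ∧
      ∀ q ∈ M.face c, q = v + M.φ (l, !c l) q • u := by
  obtain ⟨u, hu, h1, h2⟩ := exists_dual hM h.1.1 h.2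
  have h3 : ∀ l', M.φ (l', c l') u = 0 := by
    refine fun l' => h2 _ (h.1.2 l') fun h => ?_
    simp only [Prod.mk.injEq] at h
    obtain ⟨rfl, h⟩ := h
    simp at h
  refine ⟨u, hu, h1, h3, fun q hq => ?_⟩
  have : q - v - M.φ (l, !c l) q • u = 0 := by
    refine h.eq_zero hM ?_ (fun l' => ?_) ?_
    · simp [hu, h.1.1.1, hq.1.1]
    · simp [h3, hq.2, h.1.2]
    · simp [h1, h.2]
  rw [sub_sub, sub_eq_zero] at this
  exact this

include hM in
theorem IsDart.unique (h : M.IsDart c l v) (h' : M.IsDart c l v') : v = v' := by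
  obtain ⟨u, -, -, -, h3⟩ := h.exists_dir hM
  have := h3 v' h'.1
  rw [h'.2] at this
  simpa using this.symm

include hM in
theorem IsDart.mem_extremePoints (h : M.IsDart c l v) : v ∈ M.poly.extremePoints ℝ := by
  refine ⟨h.1.1, fun x hx y hy hv => ?_⟩
  have : x - v = 0 := by
    refine h.eq_zero hM ?_ (fun l' => ?_) ?_
    · simp [h.1.1.1, hx.1]
    · simp [h.1.2, M.eq_zero_of_mem_openSegment hx hy hv (h.1.2 l')]
    · simp [h.2, M.eq_zero_of_mem_openSegment hx hy hv h.2]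
  exact sub_eq_zero.1 this

include hM in
/-- Two different endpoints cut out the face. -/
theorem IsDart.face_eq_segment (h : M.IsDart c l v) (h' : M.IsDart c l' v') (hl : l ≠ l') :
    M.face c = segment ℝ v v' := by
  refine Set.Subset.antisymm (fun q hq => ?_) ((M.convex_face c).segment_subset h.1 h'.1)
  obtain ⟨u, hu, h1, h2, h3⟩ := h.exists_dir hM
  set a := M.φ (l, !c l) v' with ha
  set b := M.φ (l, !c l) q with hb
  have hv' := h3 v' h'.1
  have hq' := h3 q hq
  have ha0 : 0 < a := lt_of_le_of_ne (h'.1.1.2 _) fun h0 => hl (h'.label_eq hM h0.symm)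
  have hb0 : 0 ≤ b := hq.1.2 _
  have hpos : 0 < M.φ (l', !c l') v :=
    lt_of_le_of_ne (h.1.1.2 _) fun h0 => hl (h.label_eq hM h0.symm).symm
  have e1 : M.φ (l', !c l') v + a * M.φ (l', !c l') u = 0 := by
    have := h'.2
    rw [hv'] at this
    simpa using this
  have e2 : 0 ≤ M.φ (l', !c l') v + b * M.φ (l', !c l') u := by
    have := hq.1.2 (l', !c l')
    rw [hq'] at this
    simpa using this
  -- In this coordinate the inequality of `l'` is affine, positive at `0` and zero at `a`, so it
  -- excludes everything beyond `a`.
  have hba : b ≤ a := by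
    by_contra! hlt
    have : M.φ (l', !c l') u < 0 := by
      by_contra! h0
      have := mul_nonneg ha0.le h0
      linarith
    nlinarith
  rw [segment_eq_image']
  refine ⟨b / a, ⟨by positivity, (div_le_one ha0).2 hba⟩, ?_⟩
  simp only
  have : v' - v = a • u := sub_eq_iff_eq_add'.2 hv'
  rw [this, smul_smul, div_mul_cancel₀ _ ha0.ne', ← hq']

include hM in
-- An edge has at most two ends: a third one would lie on the segment between the other two and yet
-- be an extreme point.
theorem IsDart.label_mem {l'' : L} {v'' : E} (h : M.IsDart c l v) (h' : M.IsDart c l' v')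
    (h'' : M.IsDart c l'' v'') (h1 : l' ≠ l) (h2 : l'' ≠ l) : l' = l'' := by
  by_contra hne
  have e := h.face_eq_segment hM h' h1.symm
  have hv : v'' ∈ segment ℝ v v' := by rw [← e]; exact h''.1
  have hx := h''.mem_extremePoints hM
  rcases (mem_extremePoints_iff_forall_segment.1 hx).2 _ h.1.1 _ h'.1.1 hv with rfl | rfl
  · exact h2 (h.label_eq hM h''.2)
  · exact hne (h''.label_eq hM h'.2)

include hM in
-- If some inequality decreased along the edge, the ratio test would produce a second end.
theorem IsDart.face_eq_ray (h : M.IsDart c l v) (h' : ∀ l' v', M.IsDart c l' v' → l' = l) :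
    ∃ u, u ≠ 0 ∧ M.ψ u = 0 ∧ M.face c = ray v u := by
  obtain ⟨u, hu, h1, h2, h3⟩ := h.exists_dir hM
  refine ⟨u, ?_, hu, ?_⟩
  · rintro rfl; simp at h1
  refine Set.Subset.antisymm (fun q hq => ⟨_, hq.1.2 _, h3 q hq⟩) ?_
  have hnn : ∀ t, 0 ≤ M.φ t u := by
    by_contra! hneg
    obtain ⟨a, ha, t, hmem, htu, ht⟩ := exists_min_ratio h.1.1 hu hneg
    have hf : v + a • u ∈ M.face c := ⟨hmem, fun l => by simp [h2, h.1.2]⟩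
    have ht2 : t.2 = !c t.1 := by
      rw [← Bool.not_eq_not, Bool.not_not]
      intro h0
      have := h2 t.1
      rw [← h0, Prod.mk.eta] at this
      exact htu.ne this
    have ht3 : t = (t.1, !c t.1) := by rw [← ht2]
    have := h' t.1 _ ⟨hf, by rw [← ht3]; exact ht⟩
    rw [this] at ht3
    rw [ht3, h1] at htu
    linarith
  rintro q ⟨a, ha, rfl⟩
  refine ⟨⟨by simp [hu, h.1.1.1], fun t => ?_⟩, fun l => by simp [h2, h.1.2]⟩
  rw [map_add, map_smul]
  exact add_nonneg (h.1.1.2 t) (smul_nonneg ha (hnn t))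

include hM in
-- The `card L` equations of the face leave a nonzero direction in the tangent space; by pointedness
-- some such direction runs into an inequality.
theorem exists_isDart (hq : q ∈ M.face c) : ∃ l v, M.IsDart c l v := by
  classical
  have hfin : Module.Finite ℝ (LinearMap.ker M.ψ) :=
    Module.finite_of_finrank_pos (by rw [hM.finrank_ker]; omega)
  let g : LinearMap.ker M.ψ →ₗ[ℝ] (L → ℝ) :=
    LinearMap.pi fun l => M.φ (l, c l) ∘ₗ (LinearMap.ker M.ψ).subtype
  have hker : LinearMap.ker g ≠ ⊥ := by
    refine LinearMap.ker_ne_bot_of_finrank_lt ?_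
    rw [Module.finrank_fintype_fun_eq_card, hM.finrank_ker]
    omega
  obtain ⟨⟨u, hu⟩, hug, hne⟩ := Submodule.exists_mem_ne_zero_of_ne_bot hker
  obtain ⟨u, hψ, hT, hlt⟩ := exists_lt_zero_of_ne_zero hM hu (by simpa using hne)
    (Set.range fun l => (l, c l)) (by rintro _ ⟨l, rfl⟩; exact congrFun hug l)
  obtain ⟨a, ha, t, hmem, htu, ht⟩ := exists_min_ratio hq.1 hψ hlt
  have hT' : ∀ l, M.φ (l, c l) u = 0 := fun l => hT _ ⟨l, rfl⟩
  have hf : q + a • u ∈ M.face c := ⟨hmem, fun l => by simp [hT', hq.2]⟩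
  have ht2 : t.2 = !c t.1 := by
    rw [← Bool.not_eq_not, Bool.not_not]
    intro h0
    have := hT' t.1
    rw [← h0, Prod.mk.eta] at this
    exact htu.ne this
  exact ⟨t.1, _, hf, by rw [← ht2]; exact ht⟩

include hM in
theorem isEdge_face (h : M.IsDart c l v) (hq : q ∈ M.face c) (hqv : q ≠ v) :
    IsEdge M.poly (M.face c) := by
  refine ⟨M.isExtreme_face c, M.convex_face c, ?_⟩
  obtain ⟨u, hu, h1, h2, h3⟩ := h.exists_dir hM
  have hu0 : u ≠ 0 := by rintro rfl; simp at h1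
  have : vectorSpan ℝ (M.face c) = ℝ ∙ u := by
    refine le_antisymm (Submodule.span_le.2 ?_) ((Submodule.span_singleton_le_iff_mem _ _).2 ?_)
    · rintro _ ⟨x, hx, y, hy, rfl⟩
      rw [h3 x hx, h3 y hy]
      simp only [vsub_eq_sub, add_sub_add_left_eq_sub, SetLike.mem_coe, ← sub_smul]
      exact Submodule.mem_span_singleton.2 ⟨_, rfl⟩
    · have hq' := h3 q hq
      have hne : M.φ (l, !c l) q ≠ 0 := fun h0 => hqv (by rw [hq', h0]; simp)
      have h4 := vsub_mem_vectorSpan ℝ hq h.1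
      have h5 : u = (M.φ (l, !c l) q)⁻¹ • (q -ᵥ v) := by
        rw [vsub_eq_sub, hq']
        simp [h1, h.2, hne]
      rw [h5]
      exact Submodule.smul_mem _ _ h4
  rw [this, finrank_span_singleton hu0]

include hM in
/-- Two faces that meet are equal or adjacent at a vertex. -/
theorem eq_or_isDart_of_mem_face (h : q ∈ M.face c) (h' : q ∈ M.face c') :
    c = c' ∨ ∃ l, M.IsDart c l q ∧ M.IsDart c' l q ∧ c' l = !c l ∧ ∀ l', l' ≠ l → c' l' = c l' := by
  by_cases hc : c = c'
  · exact Or.inl hc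
  right
  obtain ⟨l, hl⟩ := Function.ne_iff.1 hc
  have hl' : c' l = !c l := by
    cases h1 : c l <;> cases h2 : c' l <;> simp_all
  have hd : M.IsDart c l q := ⟨h, by rw [← hl']; exact h'.2 l⟩
  refine ⟨l, hd, ⟨h', by rw [hl', Bool.not_not]; exact h.2 l⟩, hl', fun l' hne => ?_⟩
  by_contra hne'
  refine hne (hd.label_eq hM ?_)
  have : c' l' = !c l' := by
    cases h1 : c l' <;> cases h2 : c' l' <;> simp_all
  rw [← this]
  exact h'.2 l'

end Dart

end PairedSystem

/-! ### Orbits of two involutions on a finite set -/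

section Involutions

variable {X : Type*} (σ τ : X → X)

/-- `y` is reached from `x` by alternating two involutions. -/
def Linked : X → X → Prop := Relation.ReflTransGen fun a b => b = σ a ∨ b = τ a

variable {σ τ} {x y z : X}

theorem Linked.refl (x : X) : Linked σ τ x x := Relation.ReflTransGen.refl

theorem Linked.trans (h : Linked σ τ x y) (h' : Linked σ τ y z) : Linked σ τ x z :=
  Relation.ReflTransGen.trans h h'

theorem Linked.left (h : Linked σ τ x y) : Linked σ τ x (σ y) := h.tail (Or.inl rfl)

theorem Linked.right (h : Linked σ τ x y) : Linked σ τ x (τ y) := h.tail (Or.inr rfl)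

theorem Linked.symm (hσ : Function.Involutive σ) (hτ : Function.Involutive τ)
    (h : Linked σ τ x y) : Linked σ τ y x := by
  induction h with
  | refl => exact Linked.refl _
  | tail _ h ih =>
    refine Relation.ReflTransGen.head ?_ ih
    rcases h with rfl | rfl
    · exact Or.inl (hσ _).symm
    · exact Or.inr (hτ _).symm

theorem Linked.iterate (n : ℕ) : Linked σ τ x ((τ ∘ σ)^[n] x) := by
  induction n with
  | zero => exact Linked.refl x
  | succ n ih =>
    rw [Function.iterate_succ_apply']
    exact ih.left.right

/-- The dihedral relation: conjugation by `σ` inverts `τ ∘ σ`. -/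
theorem iterate_conj (hσ : Function.Involutive σ) (hτ : Function.Involutive τ) (n : ℕ) :
    (τ ∘ σ)^[n] (σ ((τ ∘ σ)^[n] x)) = σ x := by
  induction n with
  | zero => rfl
  | succ n ih =>
    rw [Function.iterate_succ_apply, Function.iterate_succ_apply']
    simp only [Function.comp_apply]
    rw [hσ, hτ, ih]

variable [Finite X]

/-- The orbit of a fixed point of `τ` is a path, whose other end is fixed by `τ`, too. -/
theorem exists_path_of_fixed (hσ : Function.Involutive σ) (hτ : Function.Involutive τ)
    (hne : ∀ x, σ x ≠ x) (hx : τ x = x) :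
    ∃ k : ℕ, (∀ i ≤ k, ∀ j ≤ k, (τ ∘ σ)^[i] x = (τ ∘ σ)^[j] x ∨
        (τ ∘ σ)^[i] x = σ ((τ ∘ σ)^[j] x) → i = j) ∧
      τ (σ ((τ ∘ σ)^[k] x)) = σ ((τ ∘ σ)^[k] x) ∧
      ∀ y, Linked σ τ x y → ∃ i ≤ k, y = (τ ∘ σ)^[i] x ∨ y = σ ((τ ∘ σ)^[i] x) := by
  have hinj : Function.Injective (τ ∘ σ) := hτ.injective.comp hσ.injective
  set N := Function.minimalPeriod (τ ∘ σ) x with hN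
  have hpos : 0 < N :=
    Function.minimalPeriod_pos_of_mem_periodicPts (hinj.mem_periodicPts x)
  have hper : (τ ∘ σ)^[N] x = x := Function.isPeriodicPt_minimalPeriod _ _
  -- Since `τ` fixes `x`, the map `σ` acts on the cyclic orbit of `τ ∘ σ` as the reflection `j ↦ N -
  -- 1 - j`.
  have key : ∀ j < N, σ ((τ ∘ σ)^[j] x) = (τ ∘ σ)^[N - 1 - j] x := by
    intro j hj
    apply hinj.iterate (j + 1)
    rw [Function.iterate_succ_apply', iterate_conj hσ hτ, ← Function.iterate_add_apply,
      show j + 1 + (N - 1 - j) = N by omega, hper, Function.comp_apply, hσ, hx]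
  have hlt : ∀ i < N, ∀ j < N, (τ ∘ σ)^[i] x = (τ ∘ σ)^[j] x → i = j := fun i hi j hj h =>
    (Function.iterate_eq_iterate_iff_of_lt_minimalPeriod hi hj).1 h
  obtain ⟨k, hk⟩ : ∃ k, N = 2 * k + 2 := by
    rcases Nat.even_or_odd' N with ⟨k, hk | hk⟩
    · exact ⟨k - 1, by omega⟩
    -- For odd `N` the reflection has a middle point, which `σ` would fix.
    · refine absurd ?_ (hne ((τ ∘ σ)^[k] x))
      rw [key k (by omega)]
      congr 2
      omega
  refine ⟨k, ?_, ?_, ?_⟩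
  · rintro i hi j hj (h | h)
    · exact hlt i (by omega) j (by omega) h
    · rw [key j (by omega)] at h
      have := hlt i (by omega) _ (by omega) h
      omega
  · have h1 := key k (by omega)
    rw [show N - 1 - k = k + 1 by omega, Function.iterate_succ_apply'] at h1
    exact h1.symm
  · intro y hy
    suffices ∃ i < N, y = (τ ∘ σ)^[i] x by
      obtain ⟨i, hi, rfl⟩ := this
      rcases le_or_gt i k with h | h
      · exact ⟨i, h, Or.inl rfl⟩
      · refine ⟨N - 1 - i, by omega, Or.inr ?_⟩
        rw [key _ (by omega)]
        congr 2
        omega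
    induction hy with
    | refl => exact ⟨0, hpos, rfl⟩
    | tail _ h ih =>
      obtain ⟨i, hi, rfl⟩ := ih
      rcases h with rfl | rfl
      · exact ⟨_, by omega, key i hi⟩
      · rcases Nat.eq_zero_or_pos i with rfl | h0
        · exact ⟨0, hpos, hx⟩
        · refine ⟨N - i, by omega, ?_⟩
          have := key (N - i) (by omega)
          have h2 := key i hi
          rw [show N - i = (N - 1 - i) + 1 by omega, Function.iterate_succ_apply', ← h2,
            Function.comp_apply, hσ]

/-- An orbit without fixed points of `τ` is a cycle. -/
theorem exists_cycle_of_not_fixed (hσ : Function.Involutive σ) (hτ : Function.Involutive τ)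
    (hne : ∀ x, σ x ≠ x) (hx : ∀ y, Linked σ τ x y → τ y ≠ y) :
    ∃ N : ℕ, 0 < N ∧ (τ ∘ σ)^[N] x = x ∧
      (∀ i < N, ∀ j < N, (τ ∘ σ)^[i] x = (τ ∘ σ)^[j] x ∨
        (τ ∘ σ)^[i] x = σ ((τ ∘ σ)^[j] x) → i = j) ∧
      ∀ y, Linked σ τ x y → ∃ i < N, y = (τ ∘ σ)^[i] x ∨ y = σ ((τ ∘ σ)^[i] x) := by
  have hinj : Function.Injective (τ ∘ σ) := hτ.injective.comp hσ.injective
  set N := Function.minimalPeriod (τ ∘ σ) x with hN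
  have hpos : 0 < N :=
    Function.minimalPeriod_pos_of_mem_periodicPts (hinj.mem_periodicPts x)
  have hper : (τ ∘ σ)^[N] x = x := Function.isPeriodicPt_minimalPeriod _ _
  -- A coincidence would give `(τ ∘ σ)^[i + j] x = σ x`; halving the exponent yields a fixed point
  -- of `σ` if `i + j` is even and one of `τ` if it is odd.
  have key : ∀ i j, (τ ∘ σ)^[i] x ≠ σ ((τ ∘ σ)^[j] x) := by
    intro i j h
    have hc : (τ ∘ σ)^[i + j] x = σ x := by
      rw [add_comm, Function.iterate_add_apply, h, iterate_conj hσ hτ]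
    rcases Nat.even_or_odd' (i + j) with ⟨e, he | he⟩
    · refine hne ((τ ∘ σ)^[e] x) (hinj.iterate e ?_)
      rw [iterate_conj hσ hτ, ← hc, ← Function.iterate_add_apply, he, two_mul]
    · refine hx (σ ((τ ∘ σ)^[e] x)) (Linked.iterate e).left (hinj.iterate e ?_)
      rw [iterate_conj hσ hτ, ← hc, ← Function.comp_apply (f := τ),
        ← Function.iterate_succ_apply' (τ ∘ σ), ← Function.iterate_add_apply, he]
      congr 1
      omega
  refine ⟨N, hpos, hper, ?_, ?_⟩
  · rintro i hi j hj (h | h)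
    · exact (Function.iterate_eq_iterate_iff_of_lt_minimalPeriod hi hj).1 h
    · exact absurd h (key i j)
  · intro y hy
    suffices ∃ i, y = (τ ∘ σ)^[i] x ∨ y = σ ((τ ∘ σ)^[i] x) by
      obtain ⟨i, hi⟩ := this
      refine ⟨i % N, Nat.mod_lt _ hpos, ?_⟩
      rwa [hN, Function.iterate_mod_minimalPeriod_eq]
    induction hy with
    | refl => exact ⟨0, Or.inl rfl⟩
    | tail _ h ih =>
      obtain ⟨i, hi⟩ := ih
      rcases h with rfl | rfl
      · rcases hi with rfl | rfl
        · exact ⟨i, Or.inr rfl⟩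
        · exact ⟨i, Or.inl (hσ _)⟩
      · rcases hi with rfl | rfl
        · refine ⟨i + N - 1, Or.inr ?_⟩
          have : (τ ∘ σ)^[i] x = (τ ∘ σ)^[(i + N - 1) + 1] x := by
            rw [show i + N - 1 + 1 = i + N by omega, Function.iterate_add_apply, hper]
          rw [this, Function.iterate_succ_apply', Function.comp_apply, hτ]
        · exact ⟨i + 1, Or.inl (Function.iterate_succ_apply' (τ ∘ σ) _ _).symm⟩

end Involutions

/-- A finite set with a fixed-point-free involution has even cardinality. -/
theorem even_card_of_involution {X : Type*} (s : Finset X) (f : X → X) (hf : ∀ x ∈ s, f x ∈ s)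
    (hff : ∀ x ∈ s, f (f x) = x) (hne : ∀ x ∈ s, f x ≠ x) : Even s.card := by
  have h : ∑ _x ∈ s, (1 : ZMod 2) = 0 :=
    Finset.sum_involution (fun x _ => f x) (fun _ _ => by decide) (fun x hx _ => hne x hx)
      (fun x hx => hf x hx) (fun x hx => hff x hx)
  rw [Finset.sum_const, nsmul_one, ZMod.natCast_eq_zero_iff_even] at h
  exact h

/-! ### Darts and their two involutions -/

namespace PairedSystem

section Darts

variable {L E W : Type*} [AddCommGroup E] [Module ℝ E] [AddCommGroup W] [Module ℝ W]
  (M : PairedSystem L E W)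

/-- The pairs of an edge and an endpoint of it, among the fully labeled edges. -/
def Dart : Type _ := {x : (L → Bool) × L // ∃ v, M.IsDart x.1 x.2 v}

instance [Finite L] : Finite M.Dart := by
  unfold Dart
  infer_instance

namespace Dart

variable {M}

/-- The endpoint. -/
def vertex (x : M.Dart) : E := x.2.choose

theorem isDart (x : M.Dart) : M.IsDart x.1.1 x.1.2 x.vertex := x.2.choose_spec

/-- The edge. -/
def edge (x : M.Dart) : Set E := M.face x.1.1

theorem vertex_mem_edge (x : M.Dart) : x.vertex ∈ x.edge := x.isDart.1

theorem ext_iff' {x y : M.Dart} : x = y ↔ x.1.1 = y.1.1 ∧ x.1.2 = y.1.2 :=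
  Subtype.ext_iff.trans Prod.ext_iff

open Classical in
/-- The other endpoint of the same edge; the same endpoint if there is no other one. -/
def opp (x : M.Dart) : M.Dart :=
  if h : ∃ y : M.Dart, y.1.1 = x.1.1 ∧ y ≠ x then h.choose else x

variable [DecidableEq L]

/-- The other edge at the same vertex. -/
def flip (x : M.Dart) : M.Dart :=
  ⟨(Function.update x.1.1 x.1.2 (!x.1.1 x.1.2), x.1.2), x.vertex, ⟨x.isDart.1.1, fun l => by
    by_cases h : l = x.1.2
    · subst h; simpa using x.isDart.2
    · simpa [h] using x.isDart.1.2 l⟩, by simpa using x.isDart.1.2 x.1.2⟩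

theorem flip_flip : Function.Involutive (flip : M.Dart → M.Dart) := by
  intro x
  rw [ext_iff']
  simp [flip]

theorem flip_ne (x : M.Dart) : x.flip ≠ x := by
  intro h
  have := congrFun (ext_iff'.1 h).1 x.1.2
  simp [flip] at this

variable [Fintype L] (hM : M.Regular) {x y : M.Dart} {p q : E}

include hM

theorem vertex_eq {v : E} (h : M.IsDart x.1.1 x.1.2 v) : x.vertex = v := x.isDart.unique hM h

theorem vertex_flip (x : M.Dart) : x.flip.vertex = x.vertex :=
  vertex_eq hM (x.flip.2.choose_spec.unique hM
    ⟨⟨x.isDart.1.1, fun l => by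
      by_cases h : l = x.1.2
      · subst h; simpa [flip] using x.isDart.2
      · simpa [h, flip] using x.isDart.1.2 l⟩, by simpa [flip] using x.isDart.1.2 x.1.2⟩ ▸
      x.flip.isDart)

theorem opp_eq (h : y.1.1 = x.1.1) (hne : y ≠ x) : x.opp = y := by
  have hex : ∃ y : M.Dart, y.1.1 = x.1.1 ∧ y ≠ x := ⟨y, h, hne⟩
  have hop : x.opp = hex.choose := dif_pos hex
  obtain ⟨h1, h2⟩ := hex.choose_spec
  rw [hop]
  generalize hex.choose = z at h1 h2
  have hy := y.isDart
  have hz := z.isDart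
  rw [h] at hy
  rw [h1] at hz
  refine ext_iff'.2 ⟨h1.trans h.symm, x.isDart.label_mem hM hz hy ?_ ?_⟩
  · exact fun h3 => h2 (ext_iff'.2 ⟨h1, h3⟩)
  · exact fun h3 => hne (ext_iff'.2 ⟨h, h3⟩)

omit [DecidableEq L] [Fintype L] hM in
theorem opp_fst (x : M.Dart) : x.opp.1.1 = x.1.1 := by
  unfold opp
  split_ifs with h
  · exact h.choose_spec.1
  · rfl

omit [DecidableEq L] [Fintype L] hM in
theorem edge_opp (x : M.Dart) : x.opp.edge = x.edge := by
  rw [edge, opp_fst, edge]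

theorem opp_opp : Function.Involutive (opp : M.Dart → M.Dart) := by
  intro x
  by_cases h : x.opp = x
  · rw [h, h]
  · exact opp_eq hM (opp_fst x).symm (Ne.symm h)

theorem eq_or_eq_opp (h : y.1.1 = x.1.1) : y = x ∨ y = x.opp := by
  by_cases hne : y = x
  · exact Or.inl hne
  · exact Or.inr (opp_eq hM h hne).symm

theorem edge_eq_segment (h : x.opp ≠ x) : x.edge = segment ℝ x.vertex x.opp.vertex := by
  have h1 := x.opp.isDart
  rw [opp_fst] at h1
  exact x.isDart.face_eq_segment hM h1 fun h2 => h (ext_iff'.2 ⟨opp_fst x, h2.symm⟩)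

theorem edge_eq_ray (h : x.opp = x) : ∃ u, u ≠ 0 ∧ M.ψ u = 0 ∧ x.edge = ray x.vertex u := by
  refine x.isDart.face_eq_ray hM fun l' v' h' => ?_
  by_contra hne
  have := opp_eq hM (x := x) (y := ⟨(x.1.1, l'), v', h'⟩) rfl
    fun h2 => hne (ext_iff'.1 h2).2
  rw [h] at this
  exact hne (ext_iff'.1 this).2.symm

theorem eq_or_eq_flip (h : x.vertex = y.vertex) : y = x ∨ y = x.flip := by
  have hy : x.vertex ∈ M.face y.1.1 := h ▸ y.isDart.1
  rcases eq_or_isDart_of_mem_face hM x.isDart.1 hy with h1 | ⟨l, h1, h2, h3, h4⟩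
  · left
    refine ext_iff'.2 ⟨h1.symm, x.isDart.label_eq hM ?_⟩
    rw [h1, h]
    exact y.isDart.2
  · right
    have hl : l = x.1.2 := x.isDart.label_eq hM h1.2
    subst hl
    refine ext_iff'.2 ⟨?_, ?_⟩
    · funext l
      by_cases hl : l = x.1.2
      · subst hl; simpa [flip] using h3
      · simpa [flip, hl] using h4 l hl
    · refine (h2.label_eq hM ?_)
      rw [h]
      exact y.isDart.2

theorem vertex_opp_ne (h : x.opp ≠ x) : x.vertex ≠ x.opp.vertex := by
  intro h'
  have h1 := (eq_or_eq_flip hM h').resolve_left h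
  have := opp_fst x
  rw [h1] at this
  have := congrFun this x.1.2
  simp [flip] at this

omit [DecidableEq L] in
-- Two different faces meet only at an end whose doubled label is the one where the choices differ,
-- and for a given label this end is unique.
theorem fst_eq_of_mem (hx : p ∈ x.edge) (hy : p ∈ y.edge) (hx' : q ∈ x.edge) (hy' : q ∈ y.edge)
    (hne : p ≠ q) : y.1.1 = x.1.1 := by
  rcases eq_or_isDart_of_mem_face hM hx hy with h1 | ⟨l, h1, h2, h3, h4⟩
  · exact h1.symm
  rcases eq_or_isDart_of_mem_face hM hx' hy' with h1' | ⟨l', h1', h2', h3', h4'⟩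
  · exact h1'.symm
  refine absurd ?_ hne
  have : l' = l := by
    by_contra hl
    have := h4 l' hl
    rw [h3'] at this
    simp at this
  subst this
  exact h1.unique hM h1'

theorem isEdge_edge (x : M.Dart) : IsEdge M.poly x.edge := by
  by_cases h : x.opp = x
  · obtain ⟨u, hu, -, he⟩ := edge_eq_ray hM h
    refine isEdge_face hM x.isDart (q := x.vertex + u) ?_ (by simpa using hu)
    have : x.vertex + u ∈ x.edge := by
      rw [he]
      exact ⟨1, zero_le_one, by simp⟩
    exact this
  · refine isEdge_face hM x.isDart (q := x.opp.vertex) ?_ (vertex_opp_ne hM h).symm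
    have := x.opp.isDart.1
    rwa [opp_fst] at this

theorem linked_of_fst_eq (h : y.1.1 = x.1.1) : Linked flip opp x y := by
  rcases eq_or_eq_opp hM h with rfl | rfl
  · exact Linked.refl _
  · exact (Linked.refl _).right

/-- Edges that meet coincide or are exchanged by `flip` at the common point; this makes different
orbits disjoint. -/
theorem linked_of_mem_edge (hx : p ∈ x.edge) (hy : p ∈ y.edge) : Linked flip opp x y := by
  rcases eq_or_isDart_of_mem_face hM hx hy with h1 | ⟨l, h1, h2, h3, h4⟩
  · exact linked_of_fst_eq hM h1.symm
  · let z : M.Dart := ⟨(x.1.1, l), p, h1⟩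
    let z' : M.Dart := ⟨(y.1.1, l), p, h2⟩
    have e1 : z.vertex = p := vertex_eq hM h1
    have e2 : z'.vertex = p := vertex_eq hM h2
    have h5 : Linked flip opp x z := linked_of_fst_eq hM rfl
    have h6 : Linked flip opp z' y := linked_of_fst_eq hM rfl
    refine h5.trans (Linked.trans ?_ h6)
    rcases eq_or_eq_flip hM (e1.trans e2.symm) with h | h
    · rw [h]; exact Linked.refl _
    · rw [h]; exact (Linked.refl _).left

end Dart

end Darts

/-! ### Orbits as paths and cycles on the 1-skeleton -/

section Orbits

variable {L E W : Type*} [DecidableEq L] [Fintype L] [NormedAddCommGroup E] [NormedSpace ℝ E]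
  [FiniteDimensional ℝ E] [NormedAddCommGroup W] [NormedSpace ℝ W]
  {M : PairedSystem L E W} (hM : M.Regular) {x y : M.Dart}

namespace Dart

/-- The union of the edges that are reached from `x`. -/
def orbit (x : M.Dart) : Set E := ⋃ y ∈ {y : M.Dart | Linked flip opp x y}, y.edge

theorem mem_orbit {p : E} : p ∈ x.orbit ↔ ∃ y : M.Dart, Linked flip opp x y ∧ p ∈ y.edge := by
  simp [orbit]

theorem edge_subset_orbit (h : Linked flip opp x y) : y.edge ⊆ x.orbit :=
  fun _ hp => mem_orbit.2 ⟨y, h, hp⟩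

include hM in
theorem orbit_eq (h : Linked flip opp x y) : x.orbit = y.orbit := by
  have h' := h.symm flip_flip (opp_opp hM)
  ext p
  rw [mem_orbit, mem_orbit]
  exact ⟨fun ⟨z, hz, hp⟩ => ⟨z, h'.trans hz, hp⟩, fun ⟨z, hz, hp⟩ => ⟨z, h.trans hz, hp⟩⟩

include hM in
theorem linked_of_mem_orbit {p : E} (hx : p ∈ x.orbit) (hy : p ∈ y.orbit) :
    Linked flip opp x y := by
  obtain ⟨x', hx', hpx⟩ := mem_orbit.1 hx
  obtain ⟨y', hy', hpy⟩ := mem_orbit.1 hy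
  exact (hx'.trans (linked_of_mem_edge hM hpx hpy)).trans (hy'.symm flip_flip (opp_opp hM))

omit [DecidableEq L] [Fintype L] in
theorem isClosed_edge (x : M.Dart) : IsClosed x.edge := by
  have : x.edge = {p | M.ψ p = M.w} ∩ (⋂ t, {p | 0 ≤ M.φ t p}) ∩
      ⋂ l, {p | M.φ (l, x.1.1 l) p = 0} := by
    ext p
    simp [edge, face, poly]
  rw [this]
  refine IsClosed.inter (IsClosed.inter ?_ (isClosed_iInter fun t => ?_))
    (isClosed_iInter fun l => ?_)
  · exact isClosed_eq (LinearMap.continuous_of_finiteDimensional _) continuous_const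
  · exact isClosed_le continuous_const (LinearMap.continuous_of_finiteDimensional _)
  · exact isClosed_eq (LinearMap.continuous_of_finiteDimensional _) continuous_const

theorem isClosed_orbit (x : M.Dart) : IsClosed x.orbit :=
  (Set.toFinite _).isClosed_biUnion fun y _ => y.isClosed_edge

include hM in
theorem isPreconnected_orbit (x : M.Dart) : IsPreconnected x.orbit := by
  refine IsPreconnected.biUnion_of_reflTransGen
    (fun y _ => (M.convex_face y.1.1).isPreconnected) fun y hy z hz => ?_
  have hyz : Linked flip opp y z := (Linked.symm flip_flip (opp_opp hM) hy).trans hz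
  induction hyz with
  | refl => exact Relation.ReflTransGen.refl
  | @tail b c hb h ih =>
    have hb' : Linked flip opp x b := Linked.trans hy hb
    refine (ih hb').tail ⟨?_, hb'⟩
    rcases h with rfl | rfl
    · exact ⟨b.vertex, b.vertex_mem_edge, vertex_flip hM b ▸ b.flip.vertex_mem_edge⟩
    · exact ⟨b.vertex, b.vertex_mem_edge, b.edge_opp ▸ b.vertex_mem_edge⟩

include hM in
theorem full_eq_iUnion_orbit : M.full = ⋃ x : M.Dart, x.orbit := by
  ext p
  rw [full_eq_iUnion, Set.mem_iUnion, Set.mem_iUnion]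
  constructor
  · rintro ⟨c, hc⟩
    obtain ⟨l, v, h⟩ := exists_isDart hM hc
    exact ⟨⟨(c, l), v, h⟩, mem_orbit.2 ⟨_, Linked.refl _, hc⟩⟩
  · rintro ⟨x, hx⟩
    obtain ⟨y, -, hy⟩ := mem_orbit.1 hx
    exact ⟨y.1.1, hy⟩

include hM in
theorem segment_flip (h : x.flip.opp ≠ x.flip) :
    segment ℝ x.vertex x.flip.opp.vertex = x.flip.edge := by
  rw [edge_eq_segment hM h, vertex_flip hM]

include hM in
theorem isEdgePath_orbit (hx : x.opp = x) :
    IsEdgePath M.poly x.orbit ∧ ∃ y : M.Dart, Linked flip opp x y ∧ y ≠ x ∧ y.opp = y := by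
  obtain ⟨k, hinj, hk, hall⟩ := exists_path_of_fixed flip_flip (opp_opp hM) flip_ne hx
  -- For positive `i` the dart `f i` lies on the edge by which the path reaches its vertex; `(f
  -- i).flip` lies on the edge that continues the path.
  set f : ℕ → M.Dart := fun i => (opp ∘ flip)^[i] x with hf
  have hs : ∀ i, f (i + 1) = (f i).flip.opp := fun i => Function.iterate_succ_apply' _ _ _
  have hl : ∀ i, Linked flip opp x (f i) := fun i => Linked.iterate i
  have hne : ∀ i < k, (f i).flip.opp ≠ (f i).flip := fun i hi h => by
    have := hinj (i + 1) (by omega) i hi.le (Or.inr ((hs i).trans h))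
    omega
  have hseg : ∀ i < k, segment ℝ (f i).vertex (f (i + 1)).vertex = (f i).flip.edge := fun i hi => by
    rw [hs, segment_flip hM (hne i hi)]
  have hyx : (f k).flip ≠ x := fun h => by
    have := hinj 0 (by omega) k le_rfl (Or.inr h.symm)
    subst this
    exact flip_ne _ h
  refine ⟨Or.inl ?_, (f k).flip, (hl k).left, hyx, hk⟩
  obtain ⟨d, hd, -, hray⟩ := edge_eq_ray hM hx
  obtain ⟨d', hd', -, hray'⟩ := edge_eq_ray hM hk
  have hray' : (f k).flip.edge = ray (f k).vertex d' := by
    rw [← vertex_flip hM]; exact hray'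
  refine ⟨k, fun i => (f i).vertex, d, d', ?_, fun i => (f i).isDart.mem_extremePoints hM,
    fun i => ?_, ?_, ?_, ?_, ?_⟩
  · intro i j h
    refine Fin.ext (hinj i (by omega) j (by omega) ?_)
    rcases eq_or_eq_flip hM (Eq.symm h) with h | h
    · exact Or.inl h
    · exact Or.inr h
  · simp only [Fin.val_castSucc, Fin.val_succ]
    rw [hseg i i.2]
    exact isEdge_edge hM _
  · exact hray ▸ isEdge_edge hM x
  · exact hray' ▸ isEdge_edge hM _
  · intro h
    have h : x.edge = (f k).flip.edge := by rw [hray, hray']; exact h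
    have hmem : x.vertex + d ∈ x.edge := by
      rw [hray]; exact ⟨1, zero_le_one, by simp⟩
    have := fst_eq_of_mem hM (p := x.vertex) (q := x.vertex + d) x.vertex_mem_edge
      (h ▸ x.vertex_mem_edge) hmem (h ▸ hmem) (by simpa using hd)
    rcases eq_or_eq_opp hM this with h | h
    · exact hyx h
    · exact hyx (h.trans hx)
  · change x.orbit = ray x.vertex d ∪ (⋃ i : Fin k, segment ℝ (f i).vertex (f (i + 1)).vertex) ∪
      ray (f k).vertex d'
    rw [← hray, ← hray']
    ext p
    simp only [Set.mem_union, Set.mem_iUnion]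
    constructor
    · intro hp
      obtain ⟨y, hy, hp⟩ := mem_orbit.1 hp
      have hfl : ∀ i ≤ k, p ∈ (f i).flip.edge →
          (p ∈ x.edge ∨ ∃ i : Fin k, p ∈ segment ℝ (f i).vertex (f (i + 1)).vertex) ∨
            p ∈ (f k).flip.edge := fun i hi h => by
        rcases hi.lt_or_eq with hi | rfl
        · exact Or.inl (Or.inr ⟨⟨i, hi⟩, (hseg i hi).symm ▸ h⟩)
        · exact Or.inr h
      obtain ⟨i, hi, rfl | rfl⟩ := hall y hy
      · cases i with
        | zero => exact Or.inl (Or.inl hp)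
        | succ i =>
          refine hfl i (by omega) ?_
          have : p ∈ (f (i + 1)).edge := hp
          rwa [hs, edge_opp] at this
      · exact hfl i hi hp
    · rintro ((hp | ⟨i, hp⟩) | hp)
      · exact edge_subset_orbit (Linked.refl _) hp
      · rw [hseg i i.2] at hp
        exact edge_subset_orbit (hl i).left hp
      · exact edge_subset_orbit (hl k).left hp

include hM in
theorem isEdgeCycle_orbit (hx : ∀ y : M.Dart, Linked flip opp x y → y.opp ≠ y) :
    IsEdgeCycle M.poly x.orbit := by
  obtain ⟨N, hN, hper, hinj, hall⟩ := exists_cycle_of_not_fixed flip_flip (opp_opp hM) flip_ne hx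
  set f : ℕ → M.Dart := fun i => (opp ∘ flip)^[i] x with hf
  have hs : ∀ i, f (i + 1) = (f i).flip.opp := fun i => Function.iterate_succ_apply' _ _ _
  have hl : ∀ i, Linked flip opp x (f i) := fun i => Linked.iterate i
  have hne : ∀ i, (f i).flip.opp ≠ (f i).flip := fun i => hx _ (hl i).left
  have hseg : ∀ i, segment ℝ (f i).vertex (f (i + 1)).vertex = (f i).flip.edge := fun i => by
    rw [hs, segment_flip hM (hne i)]
  have hvne : ∀ i, (f i).vertex ≠ (f (i + 1)).vertex := fun i => by
    rw [hs, ← vertex_flip hM]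
    exact vertex_opp_ne hM (hne i)
  have h0 : f N = f 0 := hper
  obtain ⟨k, rfl⟩ : ∃ k, N = k + 3 := by
    refine ⟨N - 3, ?_⟩
    have h1 : N ≠ 1 := by
      rintro rfl
      exact hvne 0 (congrArg vertex h0.symm)
    -- Two edges with the same pair of ends are the same face, which would make a dart equal to its
    -- `flip` or break the injectivity.
    have h2 : N ≠ 2 := by
      rintro rfl
      have e1 := hseg 0
      have e2 := hseg 1
      simp only [zero_add, Nat.reduceAdd] at e1 e2
      rw [h0, segment_symm, e1] at e2
      have ha : (f 0).vertex ∈ (f 0).flip.edge := by rw [← e1]; exact left_mem_segment ..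
      have hb : (f 1).vertex ∈ (f 0).flip.edge := by rw [← e1]; exact right_mem_segment ..
      have := fst_eq_of_mem hM ha (e2 ▸ ha) hb (e2 ▸ hb) (hvne 0)
      rcases eq_or_eq_opp hM this with h | h
      · have := hinj 1 (by omega) 0 (by omega) (Or.inl (flip_flip.injective h))
        omega
      · rw [← hs] at h
        exact flip_ne _ h
    omega
  have hmod : ∀ i : Fin (k + 3), f (i + 1 : Fin (k + 3)).val = f (i.val + 1) := fun i => by
    rw [Fin.val_add_one]
    split_ifs with h
    · rw [h, ← h0]; rfl
    · rfl
  refine ⟨k, fun i => (f i).vertex, ?_, fun i => (f i).isDart.mem_extremePoints hM,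
    fun i => ?_, ?_⟩
  · intro i j h
    refine Fin.ext (hinj i i.2 j j.2 ?_)
    rcases eq_or_eq_flip hM (Eq.symm h) with h | h
    · exact Or.inl h
    · exact Or.inr h
  · simp only [hmod, hseg]
    exact isEdge_edge hM _
  · ext p
    simp only [hmod, hseg, Set.mem_iUnion]
    constructor
    · intro hp
      obtain ⟨y, hy, hp⟩ := mem_orbit.1 hp
      obtain ⟨i, hi, rfl | rfl⟩ := hall y hy
      · cases i with
        | zero =>
          refine ⟨⟨k + 2, by omega⟩, ?_⟩
          have : p ∈ (f (k + 2 + 1)).edge := by rw [show f (k + 2 + 1) = f 0 from h0]; exact hp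
          rwa [hs, edge_opp] at this
        | succ i =>
          refine ⟨⟨i, by omega⟩, ?_⟩
          have : p ∈ (f (i + 1)).edge := hp
          rwa [hs, edge_opp] at this
      · exact ⟨⟨i, hi⟩, hp⟩
    · rintro ⟨i, hp⟩
      exact edge_subset_orbit (hl i).left hp

end Dart

end Orbits

end PairedSystem

/-! ### Parity of the intersections with a hyperplane -/

namespace PairedSystem
section Parity

variable {L E W : Type*} [DecidableEq L] [Fintype L] [NormedAddCommGroup E] [NormedSpace ℝ E]
  [FiniteDimensional ℝ E] [NormedAddCommGroup W] [NormedSpace ℝ W]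
  {M : PairedSystem L E W} (hM : M.Regular) {x y : M.Dart} {h : E →ₗ[ℝ] ℝ}

namespace Dart

include hM

/-- A linear functional without zeros at the vertices has at most one zero on every edge. -/
theorem eq_of_mem_edge_of_eq_zero (hv : h x.vertex ≠ 0) {p q : E} (hp : p ∈ x.edge)
    (hq : q ∈ x.edge) (hp0 : h p = 0) (hq0 : h q = 0) : p = q := by
  obtain ⟨u, -, -, -, h3⟩ := x.isDart.exists_dir hM
  rw [h3 p hp] at hp0 ⊢
  rw [h3 q hq] at hq0 ⊢
  simp only [map_add, map_smul, smul_eq_mul] at hp0 hq0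
  have hu : h u ≠ 0 := by
    intro hu
    rw [hu, mul_zero, add_zero] at hp0
    exact hv hp0
  have : M.φ (x.1.2, !x.1.1 x.1.2) p = M.φ (x.1.2, !x.1.1 x.1.2) q := by
    apply mul_right_cancel₀ hu
    linarith
  rw [this]

theorem exists_zero_iff (ho : x.opp ≠ x) (hv : ∀ y : M.Dart, h y.vertex ≠ 0) :
    (∃ p ∈ x.edge, h p = 0) ↔
      (0 < h x.vertex ∧ h x.opp.vertex < 0) ∨ (h x.vertex < 0 ∧ 0 < h x.opp.vertex) := by
  rw [edge_eq_segment hM ho]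
  constructor
  · rintro ⟨p, ⟨a, b, ha, hb, hab, rfl⟩, h0⟩
    simp only [map_add, map_smul, smul_eq_mul] at h0
    rcases lt_or_gt_of_ne (hv x) with h1 | h1 <;> rcases lt_or_gt_of_ne (hv x.opp) with h2 | h2
    · exfalso
      have e1 := mul_nonneg ha (neg_nonneg.2 h1.le)
      have e2 := mul_nonneg hb (neg_nonneg.2 h2.le)
      have e3 : a * h x.vertex = 0 := by linarith
      have e4 : b * h x.opp.vertex = 0 := by linarith
      rw [mul_eq_zero, or_iff_left h1.ne] at e3
      rw [mul_eq_zero, or_iff_left h2.ne] at e4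
      linarith
    · exact Or.inr ⟨h1, h2⟩
    · exact Or.inl ⟨h1, h2⟩
    · exfalso
      have e1 := mul_nonneg ha h1.le
      have e2 := mul_nonneg hb h2.le
      have e3 : a * h x.vertex = 0 := by linarith
      have e4 : b * h x.opp.vertex = 0 := by linarith
      rw [mul_eq_zero, or_iff_left h1.ne'] at e3
      rw [mul_eq_zero, or_iff_left h2.ne'] at e4
      linarith
  · intro hc
    have hd : h x.vertex - h x.opp.vertex ≠ 0 := by
      rcases hc with ⟨h1, h2⟩ | ⟨h1, h2⟩ <;> intro h3 <;> linarith
    refine ⟨_, ⟨- h x.opp.vertex / (h x.vertex - h x.opp.vertex),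
      h x.vertex / (h x.vertex - h x.opp.vertex), ?_, ?_, ?_, rfl⟩, ?_⟩
    · rcases hc with ⟨h1, h2⟩ | ⟨h1, h2⟩
      · exact div_nonneg (by linarith) (by linarith)
      · exact div_nonneg_of_nonpos (by linarith) (by linarith)
    · rcases hc with ⟨h1, h2⟩ | ⟨h1, h2⟩
      · exact div_nonneg (by linarith) (by linarith)
      · exact div_nonneg_of_nonpos (by linarith) (by linarith)
    · field_simp
      ring
    · simp only [map_add, map_smul, smul_eq_mul]
      ring

omit hM in
theorem exists_zero_iff_of_ray {u : E} (he : x.edge = ray x.vertex u) (hu : h u ≠ 0)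
    (hv : h x.vertex ≠ 0) : (∃ p ∈ x.edge, h p = 0) ↔ h x.vertex / h u < 0 := by
  rw [he]
  constructor
  · rintro ⟨p, ⟨a, ha, rfl⟩, h0⟩
    simp only [map_add, map_smul, smul_eq_mul] at h0
    have : h x.vertex / h u = -a := by
      rw [div_eq_iff hu]
      linarith
    rw [this]
    refine neg_lt_zero.2 (lt_of_le_of_ne ha ?_)
    rintro rfl
    simp at h0
    exact hv h0
  · intro hlt
    refine ⟨_, ⟨-(h x.vertex / h u), by linarith, rfl⟩, ?_⟩
    simp only [map_add, map_smul, smul_eq_mul]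
    field_simp
    ring

/-- The zeros of `h` on an orbit correspond to darts that represent the edges crossing `h = 0`. -/
theorem ncard_orbit_inter (hv : ∀ y : M.Dart, h y.vertex ≠ 0) (x : M.Dart) :
    (x.orbit ∩ {p | h p = 0}).Finite ∧ (x.orbit ∩ {p | h p = 0}).ncard =
      {y : M.Dart | Linked flip opp x y ∧ ((y.opp ≠ y ∧ 0 < h y.vertex ∧ h y.opp.vertex < 0) ∨
        (y.opp = y ∧ ∃ p ∈ y.edge, h p = 0))}.ncard := by
  -- A bounded edge that crosses `h = 0` is represented by its positive end, a crossing ray by its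
  -- only end.
  set G := {y : M.Dart | Linked flip opp x y ∧
    ((y.opp ≠ y ∧ 0 < h y.vertex ∧ h y.opp.vertex < 0) ∨
        (y.opp = y ∧ ∃ p ∈ y.edge, h p = 0))} with hG
  have hz : ∀ y : M.Dart, ∃ p, y ∈ G → p ∈ y.edge ∧ h p = 0 := by
    intro y
    by_cases hy : y ∈ G
    · obtain ⟨-, ⟨h1, h2⟩ | ⟨-, p, hp⟩⟩ := hy
      · obtain ⟨p, hp⟩ := (exists_zero_iff hM h1 hv).2 (Or.inl h2)
        exact ⟨p, fun _ => hp⟩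
      · exact ⟨p, fun _ => hp⟩
    · exact ⟨0, fun h => absurd h hy⟩
  choose z hz using hz
  have himg : x.orbit ∩ {p | h p = 0} = z '' G := by
    ext p
    constructor
    · rintro ⟨hp, hp0⟩
      obtain ⟨y, hy, hp⟩ := mem_orbit.1 hp
      by_cases ho : y.opp = y
      · have hyG : y ∈ G := ⟨hy, Or.inr ⟨ho, p, hp, hp0⟩⟩
        exact ⟨y, hyG, eq_of_mem_edge_of_eq_zero hM (hv y) (hz y hyG).1 hp (hz y hyG).2 hp0⟩
      · rcases (exists_zero_iff hM ho hv).1 ⟨p, hp, hp0⟩ with h1 | h1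
        · have hyG : y ∈ G := ⟨hy, Or.inl ⟨ho, h1⟩⟩
          exact ⟨y, hyG, eq_of_mem_edge_of_eq_zero hM (hv y) (hz y hyG).1 hp (hz y hyG).2 hp0⟩
        · have hyG : y.opp ∈ G := by
            refine ⟨hy.right, Or.inl ⟨?_, ?_⟩⟩
            · rw [opp_opp hM]; exact Ne.symm ho
            · rw [opp_opp hM]; exact ⟨h1.2, h1.1⟩
          refine ⟨y.opp, hyG, eq_of_mem_edge_of_eq_zero hM (hv y) ?_ hp (hz _ hyG).2 hp0⟩
          rw [← edge_opp]
          exact (hz _ hyG).1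
    · rintro ⟨y, hy, rfl⟩
      exact ⟨edge_subset_orbit hy.1 (hz y hy).1, (hz y hy).2⟩
  have hinj : Set.InjOn z G := by
    intro y hy y' hy' heq
    have h1 := hz y hy
    have h2 := hz y' hy'
    rw [← heq] at h2
    have hc : y.1.1 = y'.1.1 := by
      rcases eq_or_isDart_of_mem_face hM h1.1 h2.1 with h3 | ⟨l, h3, -⟩
      · exact h3
      · exfalso
        let w : M.Dart := ⟨(y.1.1, l), z y, h3⟩
        have hw : w.vertex = z y := vertex_eq hM h3
        exact hv w (hw ▸ h1.2)
    rcases eq_or_eq_opp hM hc with h3 | h3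
    · exact h3
    by_contra hne
    have hne' : y'.opp ≠ y' := fun h4 => hne (h3.trans h4)
    have hne2 : y.opp ≠ y := by
      rw [h3, opp_opp hM]; exact Ne.symm hne'
    have h4 := (hy'.2.resolve_right fun h => hne' h.1).2
    have h5 := (hy.2.resolve_right fun h => hne2 h.1).2
    rw [h3] at h5
    linarith [h5.1, h4.2]
  rw [himg]
  exact ⟨(Set.toFinite G).image z, hinj.ncard_image⟩

open Classical in
-- `flip` pairs off all darts of the orbit with a positive vertex, and `opp` pairs off those whose
-- edge has a second end that is also positive. What remains is even in number.
theorem even_ncard_positive (hv : ∀ y : M.Dart, h y.vertex ≠ 0) (x : M.Dart) :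
    Even {y : M.Dart | Linked flip opp x y ∧ 0 < h y.vertex ∧
      (y.opp = y ∨ h y.opp.vertex < 0)}.ncard := by
  have := Fintype.ofFinite M.Dart
  set D := {y : M.Dart | Linked flip opp x y ∧ 0 < h y.vertex}
  set F := {y : M.Dart | Linked flip opp x y ∧ 0 < h y.vertex ∧
      (y.opp = y ∨ h y.opp.vertex < 0)}
  have hFD : F ⊆ D := fun y hy => ⟨hy.1, hy.2.1⟩
  have hD : Even D.ncard := by
    rw [Set.ncard_eq_toFinset_card']
    refine even_card_of_involution _ flip ?_ (fun y _ => flip_flip y) fun y _ => flip_ne y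
    intro y hy
    rw [Set.mem_toFinset] at hy ⊢
    exact ⟨hy.1.left, by rw [vertex_flip hM]; exact hy.2⟩
  have hDF : Even (D \ F).ncard := by
    rw [Set.ncard_eq_toFinset_card']
    have hmem : ∀ y ∈ D \ F, y.opp ≠ y ∧ 0 < h y.opp.vertex := by
      rintro y ⟨hy, hyF⟩
      refine ⟨fun h1 => hyF ⟨hy.1, hy.2, Or.inl h1⟩, ?_⟩
      refine lt_of_le_of_ne (not_lt.1 fun h1 => hyF ⟨hy.1, hy.2, Or.inr h1⟩) (hv _).symm
    refine even_card_of_involution _ opp ?_ (fun y _ => opp_opp hM y) ?_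
    · intro y hy
      rw [Set.mem_toFinset] at hy ⊢
      have h1 := hmem y hy
      refine ⟨⟨hy.1.1.right, h1.2⟩, fun h2 => ?_⟩
      have h3 := h2.2.2
      rw [opp_opp hM] at h3
      rcases h3 with h3 | h3
      · exact h1.1 h3.symm
      · linarith [hy.1.2]
    · intro y hy
      rw [Set.mem_toFinset] at hy
      exact (hmem y hy).1
  have := Set.ncard_sdiff_add_ncard_of_subset hFD (Set.toFinite D)
  rw [← this] at hD
  exact (Nat.even_add.1 hD).1 hDF

theorem even_ncard_orbit_inter (hv : ∀ y : M.Dart, h y.vertex ≠ 0)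
    (hx : ∀ y : M.Dart, Linked flip opp x y → y.opp ≠ y) :
    Even (x.orbit ∩ {p | h p = 0}).ncard := by
  rw [(ncard_orbit_inter hM hv x).2]
  convert even_ncard_positive hM hv x using 4 with y
  refine and_congr_right fun hy => ?_
  simp [hx y hy]

/-- The even count of `even_ncard_positive` includes a ray if its vertex is positive, whereas the
zeros include it if it crosses. On the ray of `xm`, where `h` decreases, these agree; on that of
`xp`, where `h` increases, they are opposite. The counts differ by one. -/
theorem odd_ncard_orbit_inter (hv : ∀ y : M.Dart, h y.vertex ≠ 0) {xm xp : M.Dart} {um up : E}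
    (hne : xp ≠ xm) (hl : Linked flip opp xm xp)
    (hfix : ∀ y : M.Dart, y.opp = y ↔ y = xp ∨ y = xm)
    (hm : xm.edge = ray xm.vertex um) (hum : h um < 0)
    (hp : xp.edge = ray xp.vertex up) (hup : 0 < h up) :
    Odd (xm.orbit ∩ {p | h p = 0}).ncard := by
  rw [(ncard_orbit_inter hM hv xm).2]
  have hF := even_ncard_positive hM hv xm
  set G := {y : M.Dart | Linked flip opp xm y ∧
    ((y.opp ≠ y ∧ 0 < h y.vertex ∧ h y.opp.vertex < 0) ∨
        (y.opp = y ∧ ∃ p ∈ y.edge, h p = 0))} with hG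
  set F := {y : M.Dart | Linked flip opp xm y ∧ 0 < h y.vertex ∧
      (y.opp = y ∨ h y.opp.vertex < 0)}
  have hxm : (∃ p ∈ xm.edge, h p = 0) ↔ 0 < h xm.vertex := by
    rw [exists_zero_iff_of_ray hm hum.ne (hv _), div_neg_iff]
    constructor
    · rintro (h1 | h1)
      · exact h1.1
      · linarith
    · exact fun h1 => Or.inl ⟨h1, hum⟩
  have hxp : (∃ p ∈ xp.edge, h p = 0) ↔ h xp.vertex < 0 := by
    rw [exists_zero_iff_of_ray hp hup.ne' (hv _), div_neg_iff]
    constructor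
    · rintro (h1 | h1)
      · linarith
      · exact h1.1
    · exact fun h1 => Or.inr ⟨h1, hup⟩
  have hiff : ∀ y, y ≠ xp → (y ∈ G ↔ y ∈ F) := by
    intro y hy
    refine and_congr_right fun _ => ?_
    by_cases ho : y.opp = y
    · obtain rfl := ((hfix y).1 ho).resolve_left hy
      simp [ho, hxm]
    · simp [ho]
  rcases lt_or_gt_of_ne (hv xp) with h1 | h1
  · have hG' : G = insert xp F := by
      ext y
      by_cases hy : y = xp
      · subst hy
        simp only [Set.mem_insert_iff, true_or, iff_true]
        exact ⟨hl, Or.inr ⟨(hfix _).2 (Or.inl rfl), hxp.2 h1⟩⟩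
      · rw [Set.mem_insert_iff, hiff y hy, or_iff_right hy]
    rw [hG', Set.ncard_insert_of_notMem]
    · exact hF.add_one
    · intro h2
      linarith [h2.2.1]
  · have hF' : F = insert xp G := by
      ext y
      by_cases hy : y = xp
      · subst hy
        simp only [Set.mem_insert_iff, true_or, iff_true]
        exact ⟨hl, h1, Or.inl ((hfix _).2 (Or.inl rfl))⟩
      · rw [Set.mem_insert_iff, hiff y hy, or_iff_right hy]
    rw [hF', Set.ncard_insert_of_notMem] at hF
    · rwa [Nat.even_add_one, Nat.not_even_iff_odd] at hF
    · rintro ⟨-, h2 | h2⟩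
      · exact h2.1 ((hfix _).2 (Or.inl rfl))
      · linarith [hxp.1 h2.2]

/-- A linear functional that changes its sign between two rays of an orbit has a zero. -/
theorem exists_zero_mem_orbit (h : E →ₗ[ℝ] ℝ) {xm xp : M.Dart} {um up : E}
    (hl : Linked flip opp xm xp)
    (hm : xm.edge = ray xm.vertex um) (hum : h um < 0)
    (hp : xp.edge = ray xp.vertex up) (hup : 0 < h up) :
    ∃ p ∈ xm.orbit, h p = 0 := by
  have hneg : ∃ p ∈ xm.orbit, h p ≤ 0 := by
    -- At this parameter the change of `h` along the ray is `-|h xm.vertex|`, enough to cancel a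
    -- positive starting value.
    refine ⟨xm.vertex + (|h xm.vertex| / (- h um)) • um, edge_subset_orbit (Linked.refl _) ?_, ?_⟩
    · rw [hm]
      exact ⟨_, div_nonneg (abs_nonneg _) (by linarith), rfl⟩
    · rw [map_add, map_smul, smul_eq_mul, div_mul_eq_mul_div, div_neg, mul_div_cancel_right₀ _ hum.ne]
      linarith [le_abs_self (h xm.vertex)]
  have hpos : ∃ p ∈ xm.orbit, 0 ≤ h p := by
    refine ⟨xp.vertex + (|h xp.vertex| / h up) • up, edge_subset_orbit hl ?_, ?_⟩
    · rw [hp]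
      exact ⟨_, div_nonneg (abs_nonneg _) hup.le, rfl⟩
    · rw [map_add, map_smul, smul_eq_mul, div_mul_cancel₀ _ hup.ne']
      linarith [neg_abs_le (h xp.vertex)]
  obtain ⟨p, hp, hp0⟩ := hneg
  obtain ⟨q, hq, hq0⟩ := hpos
  obtain ⟨r, hr, hr0⟩ := (isPreconnected_orbit hM xm).intermediate_value hp hq
    (LinearMap.continuous_of_finiteDimensional h).continuousOn ⟨hp0, hq0⟩
  exact ⟨r, hr, hr0⟩

end Dart

end Parity

end PairedSystem

/-! ### P × Q' as a paired system -/

section System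

variable {m n : ℕ} (A C : Matrix (Fin m) (Fin n) ℝ) (β : Fin n → ℝ)

/-- The slack of the inequalities of `P` (`true`) and of `Q'` (`false`), by label. -/
def slack : (Fin m ⊕ Fin n) × Bool → Pt m n → ℝ
  | (Sum.inl i, true), p => p.1.2 - (A *ᵥ p.1.1) i
  | (Sum.inr j, true), p => p.1.1 j
  | (Sum.inl i, false), p => p.2.1 i
  | (Sum.inr j, false), p => p.2.2.2 - ((p.2.1 ᵥ* C) j + β j * p.2.2.1)

/-- The polyhedron `P × Q'` as a paired system. -/
def gameSystem : PairedSystem (Fin m ⊕ Fin n) (Pt m n) (ℝ × ℝ) where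
  φ t :=
    { toFun := slack A C β t
      map_add' := by
        intro p q
        obtain ⟨i | j, _ | _⟩ := t <;>
          simp only [slack, Prod.fst_add, Prod.snd_add, Matrix.mulVec_add, Matrix.add_vecMul,
            Pi.add_apply] <;> ring
      map_smul' := by
        intro a p
        obtain ⟨i | j, _ | _⟩ := t <;>
          simp only [slack, Prod.smul_fst, Prod.smul_snd, Matrix.mulVec_smul, Matrix.smul_vecMul,
            Pi.smul_apply, smul_eq_mul, RingHom.id_apply] <;> ring }
  ψ :=
    { toFun := fun p => (∑ j, p.1.1 j, ∑ i, p.2.1 i)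
      map_add' := by
        intro p q
        simp [Finset.sum_add_distrib]
      map_smul' := by
        intro a p
        simp [Finset.mul_sum] }
  w := (1, 1)

/-- The linear functional that defines the hyperplane of `G(α)`. -/
def gap (α : Fin m → ℝ) : Pt m n →ₗ[ℝ] ℝ where
  toFun p := p.2.2.1 - ∑ i, α i * p.2.1 i
  map_add' p q := by
    simp only [Prod.snd_add, Prod.fst_add, Pi.add_apply, mul_add, Finset.sum_add_distrib]
    ring
  map_smul' a p := by
    simp only [Prod.smul_snd, Prod.smul_fst, Pi.smul_apply, smul_eq_mul, RingHom.id_apply, mul_sub,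
      Finset.mul_sum]
    congr 1
    exact Finset.sum_congr rfl fun i _ => by ring

variable {A C β}

theorem gameSystem_φ (t : (Fin m ⊕ Fin n) × Bool) (p : Pt m n) :
    (gameSystem A C β).φ t p = slack A C β t p := rfl

theorem gameSystem_ψ (p : Pt m n) :
    (gameSystem A C β).ψ p = (∑ j, p.1.1 j, ∑ i, p.2.1 i) := rfl

theorem gameSystem_ψ_eq_zero {p : Pt m n} :
    (gameSystem A C β).ψ p = 0 ↔ ∑ j, p.1.1 j = 0 ∧ ∑ i, p.2.1 i = 0 := by
  rw [gameSystem_ψ, Prod.ext_iff]; rfl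

theorem poly_gameSystem : (gameSystem A C β).poly = polyP A ×ˢ polyQ' C β := by
  ext p
  simp only [PairedSystem.poly, polyP, polyQ', stdSimplex, Set.mem_prod, Set.mem_ofPred_eq,
    gameSystem_φ, gameSystem_ψ, Prod.forall, Sum.forall, Bool.forall_bool, slack, sub_nonneg]
  have : (gameSystem A C β).w = (1, 1) := rfl
  rw [this, Prod.ext_iff]
  simp only [forall_and]
  tauto

theorem mem_poly_iff {p : Pt m n} :
    p ∈ (gameSystem A C β).poly ↔ p.1 ∈ polyP A ∧ p.2 ∈ polyQ' C β := by
  rw [poly_gameSystem, Set.mem_prod]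

theorem slack_true_eq_zero {l : Fin m ⊕ Fin n} {p : Pt m n} :
    slack A C β (l, true) p = 0 ↔ l ∈ labelP A p.1 := by
  cases l with
  | inl i => simp only [slack, labelP, Set.mem_ofPred_eq, Sum.elim_inl, sub_eq_zero, eq_comm]
  | inr j => simp only [slack, labelP, Set.mem_ofPred_eq, Sum.elim_inr]

theorem slack_false_eq_zero {l : Fin m ⊕ Fin n} {p : Pt m n} :
    slack A C β (l, false) p = 0 ↔ l ∈ labelQ' C β p.2 := by
  cases l with
  | inl i => simp only [slack, labelQ', Set.mem_ofPred_eq, Sum.elim_inl]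
  | inr j => simp only [slack, labelQ', Set.mem_ofPred_eq, Sum.elim_inr, sub_eq_zero, eq_comm]

theorem full_gameSystem : (gameSystem A C β).full = fullyLabeled A C β := by
  ext p
  simp only [PairedSystem.full, fullyLabeled, Set.mem_ofPred_eq, poly_gameSystem, gameSystem_φ,
    Bool.exists_bool, slack_true_eq_zero, slack_false_eq_zero, Set.eq_univ_iff_forall,
    Set.mem_union, or_comm]

theorem ncard_tight (p : Pt m n) :
    {t | (gameSystem A C β).φ t p = 0}.ncard = (labelP A p.1).ncard + (labelQ' C β p.2).ncard := by
  have : {t | (gameSystem A C β).φ t p = 0} =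
      (fun l => (l, true)) '' labelP A p.1 ∪ (fun l => (l, false)) '' labelQ' C β p.2 := by
    ext ⟨l, s⟩
    cases s <;> simp [gameSystem_φ, slack_true_eq_zero, slack_false_eq_zero]
  rw [this, Set.ncard_union_eq, Set.ncard_image_of_injective _ (Prod.mk_left_injective _),
    Set.ncard_image_of_injective _ (Prod.mk_left_injective _)]
  rw [Set.disjoint_left]
  rintro _ ⟨l, -, rfl⟩ ⟨l', -, h⟩
  simp at h

theorem finrank_ker_gameSystem (hm : 0 < m) (hn : 0 < n) :
    Module.finrank ℝ (LinearMap.ker (gameSystem A C β).ψ) = m + n + 1 := by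
  have h := LinearMap.finrank_range_add_finrank_ker (gameSystem A C β).ψ
  have hr : LinearMap.range (gameSystem A C β).ψ = ⊤ := by
    rw [LinearMap.range_eq_top]
    rintro ⟨a, b⟩
    refine ⟨((Pi.single ⟨0, hn⟩ a, 0), (Pi.single ⟨0, hm⟩ b, 0, 0)), ?_⟩
    simp [gameSystem_ψ]
  rw [hr, finrank_top] at h
  simp only [Module.finrank_prod, Module.finrank_self, Module.finrank_fintype_fun_eq_card,
    Fintype.card_fin] at h
  omega

/-- A line could only move λ and π₂, with change of π₂ equal to `β j` times that of λ for every `j`;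
two different values of `β` exclude it. -/
theorem regular_gameSystem (hm : 0 < m) (hn : 0 < n) (hP : NondegP A) (hQ : NondegQ' C β)
    (hβ : ∃ j j', β j ≠ β j') : (gameSystem A C β).Regular where
  pointed u hu h := by
    have hx : u.2.1 = 0 := funext fun i => h (Sum.inl i, false)
    have hy : u.1.1 = 0 := funext fun j => h (Sum.inr j, true)
    have h1 := h (Sum.inl ⟨0, hm⟩, true)
    have h2 : ∀ j, u.2.2.2 = β j * u.2.2.1 := by
      intro j
      have := h (Sum.inr j, false)
      simp only [gameSystem_φ, slack, hx, Matrix.zero_vecMul, Pi.zero_apply, zero_add] at this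
      linarith
    simp only [gameSystem_φ, slack, hy, Matrix.mulVec_zero, Pi.zero_apply, sub_zero] at h1
    obtain ⟨j, j', hj⟩ := hβ
    have h3 : u.2.2.1 = 0 := by
      have := (h2 j).symm.trans (h2 j')
      by_contra h0
      exact hj (mul_right_cancel₀ h0 this)
    have h4 : u.2.2.2 = 0 := by rw [h2 j, h3, mul_zero]
    exact Prod.ext (Prod.ext hy h1) (Prod.ext hx (Prod.ext h3 h4))
  finrank_ker := by
    rw [finrank_ker_gameSystem hm hn, Fintype.card_sum, Fintype.card_fin, Fintype.card_fin]
  card_tight_le p hp := by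
    rw [mem_poly_iff] at hp
    have h1 := hP _ hp.1
    have h2 := hQ _ hp.2
    rw [ncard_tight, Fintype.card_sum, Fintype.card_fin, Fintype.card_fin]
    omega

theorem vecMul_payoff (α : Fin m → ℝ) (x : Fin m → ℝ) (j : Fin n) :
    (x ᵥ* payoff C β α) j = (x ᵥ* C) j + β j * ∑ i, α i * x i := by
  simp only [payoff, Matrix.vecMul, dotProduct, Matrix.add_apply, Matrix.vecMulVec_apply, mul_add,
    Finset.sum_add_distrib, Finset.mul_sum]
  congr 1
  exact Finset.sum_congr rfl fun i _ => by ring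

theorem polyQ_payoff_iff {α : Fin m → ℝ} {x : Fin m → ℝ} {l r : ℝ} (h : l = ∑ i, α i * x i) :
    (x, r) ∈ polyQ (payoff C β α) ↔ (x, l, r) ∈ polyQ' C β := by
  subst h
  simp only [polyQ, polyQ', Set.mem_ofPred_eq, vecMul_payoff]

theorem labelQ_payoff {α : Fin m → ℝ} {x : Fin m → ℝ} {l r : ℝ} (h : l = ∑ i, α i * x i) :
    labelQ (payoff C β α) (x, r) = labelQ' C β (x, l, r) := by
  subst h
  simp only [labelQ, labelQ', vecMul_payoff]

/-- A vertex has m + n + 1 tight inequalities, at most n of them in P. On H_α the part in Q' is a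
point of Q for the game G(α) with the same labels, hence at most m: too few. -/
theorem gap_vertex_ne_zero (hm : 0 < m) (hn : 0 < n) (hP : NondegP A) (hQ' : NondegQ' C β)
    (hβ : ∃ j j', β j ≠ β j') {α : Fin m → ℝ} (hQ : NondegQ (payoff C β α))
    (y : (gameSystem A C β).Dart) : gap α y.vertex ≠ 0 := by
  intro h
  have hM := regular_gameSystem hm hn hP hQ' hβ
  have h1 := y.isDart.tight_eq hM
  have h2 := ncard_tight (A := A) (C := C) (β := β) y.vertex
  have h3 := mem_poly_iff.1 y.isDart.1.1
  have hl : y.vertex.2.2.1 = ∑ i, α i * y.vertex.2.1 i := sub_eq_zero.1 h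
  rw [h1, PairedSystem.ncard_insert_graph, Fintype.card_sum, Fintype.card_fin, Fintype.card_fin] at h2
  have h4 := hP _ h3.1
  have h5 := hQ _ ((polyQ_payoff_iff hl).2 h3.2)
  rw [labelQ_payoff hl] at h5
  change (labelQ' C β y.vertex.2).ncard ≤ m at h5
  omega

end System

/-! ### The two unbounded edges -/

section Rays

variable {m n : ℕ} {A C : Matrix (Fin m) (Fin n) ℝ} {β : Fin n → ℝ}

theorem exists_pos_of_mem_stdSimplex {ι : Type*} [Fintype ι] {x : ι → ℝ}
    (hx : x ∈ stdSimplex ℝ ι) : ∃ i, 0 < x i := by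
  by_contra! h
  have := Finset.sum_nonpos fun i (_ : i ∈ Finset.univ) => h i
  rw [hx.2] at this
  linarith

theorem eq_single_of_mem_stdSimplex {ι : Type*} [Fintype ι] [DecidableEq ι] {x : ι → ℝ}
    (hx : x ∈ stdSimplex ℝ ι) {i : ι} (h : ∀ j, j ≠ i → x j = 0) : x = Pi.single i 1 := by
  have h1 := hx.2
  rw [Finset.sum_eq_single i (fun j _ hj => h j hj) (by simp)] at h1
  funext j
  by_cases hj : j = i
  · subst hj; simp [h1]
  · simp [h j hj, hj]

/-- In a non-degenerate game the best response to a pure strategy is unique. -/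
theorem argmax_unique (hP : NondegP A) {j : Fin n} {i i' : Fin m} (hi : ∀ k, A k j ≤ A i j)
    (hi' : A i' j = A i j) : i' = i := by
  by_contra hne
  have hmem : ((Pi.single j 1, A i j) : (Fin n → ℝ) × ℝ) ∈ polyP A := by
    refine ⟨single_mem_stdSimplex ℝ j, fun k => ?_⟩
    simpa using hi k
  have h := hP _ hmem
  -- The n - 1 zeros of `e_j` and two best replies would be n + 1 labels.
  have hsub : insert (Sum.inl i) (insert (Sum.inl i') (Sum.inr '' {j}ᶜ)) ⊆
      labelP A (Pi.single j 1, A i j) := by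
    rintro _ (rfl | rfl | ⟨k, hk, rfl⟩)
    · simp [labelP]
    · simp [labelP, hi']
    · have hk' : k ≠ j := hk
      simp [labelP, hk']
  have h1 := Set.ncard_le_ncard hsub
  rw [Set.ncard_insert_of_notMem, Set.ncard_insert_of_notMem,
    Set.ncard_image_of_injective _ Sum.inr_injective, Set.ncard_compl] at h1
  · simp only [Nat.card_eq_fintype_card, Fintype.card_fin, Set.ncard_singleton] at h1
    have := j.2
    omega
  · simp
  · simpa using Ne.symm hne

/-- The labels of the unbounded edge with `y = e_j` and `x = e_i`. -/
def rayLabel (i : Fin m) (j : Fin n) : Fin m ⊕ Fin n → Bool :=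
  Sum.elim (fun k => decide (k = i)) fun k => decide (k ≠ j)

/-- A recession direction has nonnegative entries in `x` and `y` with sum zero, so these vanish; a
played row then fixes π₁. The slacks of the columns force the played columns to maximize `β k *
u.2.2.1`. If the maximizer is unique, `y` is pure, the best reply is unique, and every choice of `c`
is determined. -/
theorem ray_direction {c : Fin m ⊕ Fin n → Bool} {q u : Pt m n} (hu0 : u ≠ 0)
    (hψ : (gameSystem A C β).ψ u = 0) (h : ray q u ⊆ (gameSystem A C β).face c) :
    u.1.1 = 0 ∧ u.2.1 = 0 ∧ u.2.2.1 ≠ 0 ∧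
      ∀ i j, NondegP A → (∀ k, A k j ≤ A i j) → (∀ k, k ≠ j → β k * u.2.2.1 < β j * u.2.2.1) →
        c = rayLabel i j := by
  have hq : q ∈ (gameSystem A C β).face c := h ⟨0, le_rfl, by simp⟩
  have hnn : ∀ t, 0 ≤ slack A C β t u := by
    intro t
    by_contra! hneg
    have h1 := hq.1.2 t
    set b := (gameSystem A C β).φ t q with hb
    -- At this point of the ray the slack would be `-1`.
    have h2 : q + ((b + 1) / (-slack A C β t u)) • u ∈ (gameSystem A C β).face c :=
      h ⟨_, div_nonneg (by linarith) (by linarith), rfl⟩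
    have h3 := h2.1.2 t
    rw [map_add, map_smul, smul_eq_mul, gameSystem_φ _ u, div_neg, neg_mul,
      div_mul_cancel₀ _ hneg.ne] at h3
    linarith
  have hz : ∀ l, slack A C β (l, c l) u = 0 := by
    intro l
    have h2 : q + (1 : ℝ) • u ∈ (gameSystem A C β).face c := h ⟨1, zero_le_one, rfl⟩
    have h3 := h2.2 l
    rwa [map_add, hq.2, zero_add, one_smul, gameSystem_φ] at h3
  obtain ⟨hs1, hs2⟩ := gameSystem_ψ_eq_zero.1 hψ
  have hy : u.1.1 = 0 := by
    have := (Finset.sum_eq_zero_iff_of_nonneg (f := u.1.1) fun j _ => hnn (Sum.inr j, true)).1 hs1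
    exact funext fun j => this j (Finset.mem_univ j)
  have hx : u.2.1 = 0 := by
    have := (Finset.sum_eq_zero_iff_of_nonneg (f := u.2.1) fun i _ => hnn (Sum.inl i, false)).1 hs2
    exact funext fun i => this i (Finset.mem_univ i)
  obtain ⟨hqP, hqQ⟩ := mem_poly_iff.1 hq.1
  obtain ⟨i₀, hi₀⟩ := exists_pos_of_mem_stdSimplex hqQ.1
  obtain ⟨j₀, hj₀⟩ := exists_pos_of_mem_stdSimplex hqP.1
  have hci : c (Sum.inl i₀) = true := by
    by_contra h1
    rw [Bool.not_eq_true] at h1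
    have := hq.2 (Sum.inl i₀)
    rw [h1] at this
    exact hi₀.ne' this
  have hcj : c (Sum.inr j₀) = false := by
    by_contra h1
    rw [Bool.not_eq_false] at h1
    have := hq.2 (Sum.inr j₀)
    rw [h1] at this
    exact hj₀.ne' this
  have hπ1 : u.1.2 = 0 := by
    have := hz (Sum.inl i₀)
    rw [hci] at this
    simpa [slack, hy] using this
  have hsl : ∀ j, slack A C β (Sum.inr j, false) u = u.2.2.2 - β j * u.2.2.1 := by
    intro j
    simp [slack, hx]
  have hπ2 : u.2.2.2 = β j₀ * u.2.2.1 := by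
    have := hz (Sum.inr j₀)
    rw [hcj, hsl] at this
    linarith
  refine ⟨hy, hx, fun h0 => ?_, fun i j hP hi hj => ?_⟩
  · rw [h0, mul_zero] at hπ2
    exact hu0 (Prod.ext (Prod.ext hy hπ1) (Prod.ext hx (Prod.ext h0 hπ2)))
  · have hj0 : ∀ k, 0 < q.1.1 k → k = j := by
      intro k hk
      by_contra hne
      have h1 : c (Sum.inr k) = false := by
        by_contra h1
        rw [Bool.not_eq_false] at h1
        have := hq.2 (Sum.inr k)
        rw [h1] at this
        exact hk.ne' this
      have h2 := hz (Sum.inr k)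
      rw [h1, hsl] at h2
      have h3 := hnn (Sum.inr j, false)
      rw [hsl] at h3
      linarith [hj k hne]
    have hj₀' := hj0 j₀ hj₀
    subst hj₀'
    have hyq : q.1.1 = Pi.single j₀ 1 := by
      refine eq_single_of_mem_stdSimplex hqP.1 fun k hk => ?_
      exact le_antisymm (not_lt.1 fun h1 => hk (hj0 k h1)) (hqP.1.1 k)
    have hA : ∀ k, (A *ᵥ q.1.1) k = A k j₀ := fun k => by rw [hyq]; simp
    have htrue : ∀ k, c (Sum.inl k) = true → A k j₀ = q.1.2 := by
      intro k hk
      have := hq.2 (Sum.inl k)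
      rw [hk] at this
      have h2 : q.1.2 - (A *ᵥ q.1.1) k = 0 := this
      rw [hA] at h2
      linarith
    have hiq : A i j₀ = q.1.2 := by
      refine le_antisymm ?_ ?_
      · rw [← hA]; exact hqP.2 i
      · rw [← htrue i₀ hci]; exact hi i₀
    have hall : ∀ k, c (Sum.inl k) = true → k = i := fun k hk =>
      argmax_unique hP hi ((htrue k hk).trans hiq.symm)
    funext l
    rcases l with k | k
    · by_cases hk : k = i
      · have := hall i₀ hci
        subst hk this
        simpa [rayLabel] using hci
      · simp only [rayLabel, Sum.elim_inl, hk, decide_false]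
        rw [← Bool.not_eq_true]
        exact fun h => hk (hall k h)
    · by_cases hk : k = j₀
      · subst hk
        simpa [rayLabel] using hcj
      · simp only [rayLabel, Sum.elim_inr, ne_eq, hk, not_false_eq_true, decide_true]
        rw [← Bool.not_eq_false]
        intro h
        have h2 := hz (Sum.inr k)
        rw [h, hsl] at h2
        linarith [hj k hk]

/-- The points of the unbounded edge with `y = e_j` and `x = e_i`. -/
def rayPoint (A C : Matrix (Fin m) (Fin n) ℝ) (β : Fin n → ℝ) (i : Fin m) (j : Fin n) (s : ℝ) :
    Pt m n :=
  ((Pi.single j 1, A i j), (Pi.single i 1, s, C i j + β j * s))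

theorem rayPoint_mem_face {i : Fin m} {j : Fin n} {s : ℝ} (hi : ∀ k, A k j ≤ A i j)
    (hs : ∀ k, C i k + β k * s ≤ C i j + β j * s) :
    rayPoint A C β i j s ∈ (gameSystem A C β).face (rayLabel i j) := by
  refine ⟨mem_poly_iff.2 ⟨⟨single_mem_stdSimplex ℝ j, fun k => ?_⟩,
    ⟨single_mem_stdSimplex ℝ i, fun k => ?_⟩⟩, fun l => ?_⟩
  · simpa [rayPoint] using hi k
  · simpa [rayPoint] using hs k
  · rw [gameSystem_φ]
    rcases l with k | k
    · by_cases hk : k = i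
      · subst hk
        simp [rayLabel, slack, rayPoint]
      · simp [rayLabel, slack, rayPoint, hk]
    · by_cases hk : k = j
      · subst hk
        simp [rayLabel, slack, rayPoint]
      · simp [rayLabel, slack, rayPoint, hk]

theorem exists_rayPoint_mem_face {i : Fin m} {j : Fin n} {ε : ℝ} (hi : ∀ k, A k j ≤ A i j)
    (hj : ∀ k, k ≠ j → β k * ε < β j * ε) (B : ℝ) :
    ∃ a, B ≤ a ∧ rayPoint A C β i j (ε * a) ∈ (gameSystem A C β).face (rayLabel i j) := by
  -- Beyond `b` the term in `β` outweighs the differences of the entries of `C`. The index `k = j`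
  -- contributes the harmless value `0 / 0 = 0`.
  obtain ⟨b, hb⟩ := (Set.finite_range fun k => (C i k - C i j) / (β j * ε - β k * ε)).bddAbove
  refine ⟨max b B, le_max_right _ _, rayPoint_mem_face hi fun k => ?_⟩
  by_cases hk : k = j
  · rw [hk]
  · have h1 := (hb ⟨k, rfl⟩).trans (le_max_left b B)
    simp only at h1
    rw [div_le_iff₀ (by linarith [hj k hk])] at h1
    linarith

/-- `ε` is the sign of λ along the ray. The explicit points `rayPoint` make `ε * λ` unbounded on the
face, so it is not a segment, and its direction has the sign of `ε`. -/
theorem exists_ray_dart (hM : (gameSystem A C β).Regular) {i : Fin m} {j : Fin n} {ε : ℝ}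
    (hi : ∀ k, A k j ≤ A i j) (hε : ε ≠ 0) (hj : ∀ k, k ≠ j → β k * ε < β j * ε) :
    ∃ x : (gameSystem A C β).Dart, x.opp = x ∧ x.1.1 = rayLabel i j ∧
      ∃ u, x.edge = ray x.vertex u ∧ u.2.1 = 0 ∧ 0 < ε * u.2.2.1 := by
  obtain ⟨a, -, ha⟩ := exists_rayPoint_mem_face (C := C) hi hj 0
  obtain ⟨l, v, hd⟩ := PairedSystem.exists_isDart hM ha
  let x : (gameSystem A C β).Dart := ⟨(rayLabel i j, l), v, hd⟩
  have hxe : x.edge = (gameSystem A C β).face (rayLabel i j) := rfl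
  have hε2 : 0 < ε * ε := mul_self_pos.2 hε
  have hbig : ∀ B, ∃ p ∈ x.edge, B < ε * p.2.2.1 := by
    intro B
    obtain ⟨a, hB, ha⟩ := exists_rayPoint_mem_face (C := C) hi hj ((B + 1) / (ε * ε))
    refine ⟨_, ha, ?_⟩
    rw [div_le_iff₀ hε2] at hB
    simp only [rayPoint]
    linarith
  have hop : x.opp = x := by
    by_contra hne
    obtain ⟨p, hp, hlt⟩ := hbig (max (ε * x.vertex.2.2.1) (ε * x.opp.vertex.2.2.1))
    rw [PairedSystem.Dart.edge_eq_segment hM hne] at hp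
    obtain ⟨s, t, hs, ht, hst, rfl⟩ := hp
    have h1 := mul_le_mul_of_nonneg_left
      (le_max_left (ε * x.vertex.2.2.1) (ε * x.opp.vertex.2.2.1)) hs
    have h2 := mul_le_mul_of_nonneg_left
      (le_max_right (ε * x.vertex.2.2.1) (ε * x.opp.vertex.2.2.1)) ht
    simp only [Prod.snd_add, Prod.fst_add, Prod.smul_snd, Prod.smul_fst, smul_eq_mul] at hlt
    set Y := max (ε * x.vertex.2.2.1) (ε * x.opp.vertex.2.2.1)
    have h3 : s * Y + t * Y = Y := by rw [← add_mul, hst, one_mul]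
    nlinarith
  obtain ⟨u, hu, hψ, he⟩ := PairedSystem.Dart.edge_eq_ray hM hop
  obtain ⟨hu1, hu2, hu3, -⟩ := ray_direction hu hψ (he ▸ hxe.le)
  refine ⟨x, hop, rfl, u, he, hu2, ?_⟩
  by_contra! hle
  obtain ⟨p, hp, hlt⟩ := hbig (ε * x.vertex.2.2.1)
  rw [he] at hp
  obtain ⟨s, hs, rfl⟩ := hp
  simp only [Prod.snd_add, Prod.fst_add, Prod.smul_snd, Prod.smul_fst, smul_eq_mul] at hlt
  nlinarith [mul_le_mul_of_nonneg_left hle hs]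

end Rays

/-! ### Connected components and bookkeeping of intersections -/

section Components

variable {E : Type*} [NormedAddCommGroup E] [NormedSpace ℝ E]

theorem ne_zero_of_isEdge_ray {K : Set E} {p d : E} (h : IsEdge K (ray p d)) : d ≠ 0 := by
  rintro rfl
  have : ray p (0 : E) = {p} := by
    ext q
    simp only [ray, smul_zero, add_zero, Set.mem_ofPred_eq, Set.mem_singleton_iff]
    exact ⟨fun ⟨_, _, h⟩ => h, fun h => ⟨0, le_rfl, h⟩⟩
  have h1 := h.2.2
  rw [this, vectorSpan_singleton, finrank_bot] at h1
  omega

theorem not_isBounded_of_ray_subset {S : Set E} {p d : E} (hd : d ≠ 0) (h : ray p d ⊆ S) :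
    ¬ Bornology.IsBounded S := by
  intro hb
  obtain ⟨R, hR⟩ := (hb.subset h).exists_norm_le
  have hd' : 0 < ‖d‖ := norm_pos_iff.2 hd
  have h0 : 0 ≤ R := (norm_nonneg p).trans (hR p ⟨0, le_rfl, by simp⟩)
  have ht : 0 ≤ (R + ‖p‖ + 1) / ‖d‖ := by positivity
  have h1 := hR _ ⟨_, ht, rfl⟩
  have h3 : ‖p + ((R + ‖p‖ + 1) / ‖d‖) • d‖ ≥ ‖((R + ‖p‖ + 1) / ‖d‖) • d‖ - ‖p‖ := by
    have := norm_sub_norm_le (((R + ‖p‖ + 1) / ‖d‖) • d) (-p)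
    rw [sub_neg_eq_add, norm_neg, add_comm _ p] at this
    exact this
  rw [norm_smul, Real.norm_of_nonneg ht, div_mul_cancel₀ _ hd'.ne'] at h3
  linarith

theorem IsEdgePath.not_isBounded {K S : Set E} (h : IsEdgePath K S) :
    ¬ Bornology.IsBounded S := by
  rcases h with ⟨k, p, d, d', -, -, -, h, -, -, rfl⟩ | ⟨p, d, h, rfl⟩
  · exact not_isBounded_of_ray_subset (ne_zero_of_isEdge_ray h)
      (Set.subset_union_left.trans Set.subset_union_left)
  · have hd : d ≠ 0 := by
      rintro rfl
      have : line p (0 : E) = {p} := by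
        ext q
        simp [line]
      have h1 := h.2.2
      rw [this, vectorSpan_singleton, finrank_bot] at h1
      omega
    exact not_isBounded_of_ray_subset (p := p) hd fun q ⟨t, _, hq⟩ => ⟨t, hq⟩

theorem IsEdgePath.nonempty {K S : Set E} (h : IsEdgePath K S) : S.Nonempty := by
  rcases Set.eq_empty_or_nonempty S with rfl | h'
  · exact absurd Bornology.isBounded_empty h.not_isBounded
  · exact h'

theorem IsEdgeCycle.isBounded {K S : Set E} (h : IsEdgeCycle K S) : Bornology.IsBounded S := by
  obtain ⟨k, p, -, -, -, rfl⟩ := h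
  refine (Bornology.isBounded_iUnion).2 fun i => ?_
  rw [← convexHull_pair, isBounded_convexHull]
  exact (Set.toFinite _).isBounded

theorem IsEdgeCycle.nonempty {K S : Set E} (h : IsEdgeCycle K S) : S.Nonempty := by
  obtain ⟨k, p, -, -, -, rfl⟩ := h
  exact ⟨p 0, Set.mem_iUnion.2 ⟨0, left_mem_segment ℝ _ _⟩⟩

/-- The union of the other sets is closed, by finiteness, and disjoint from `S`, so a preconnected
set that meets `S` cannot reach it. -/
theorem connectedComponentIn_eq_of_mem {𝒮 : Set (Set E)} (hfin : 𝒮.Finite)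
    (hcl : ∀ S ∈ 𝒮, IsClosed S) (hpre : ∀ S ∈ 𝒮, IsPreconnected S)
    (hdisj : ∀ S ∈ 𝒮, ∀ T ∈ 𝒮, (S ∩ T).Nonempty → S = T) {S : Set E} (hS : S ∈ 𝒮) {p : E}
    (hp : p ∈ S) : connectedComponentIn (⋃₀ 𝒮) p = S := by
  have hpN : p ∈ ⋃₀ 𝒮 := ⟨S, hS, hp⟩
  refine Set.Subset.antisymm ?_
    ((hpre S hS).subset_connectedComponentIn hp (Set.subset_sUnion_of_mem hS))
  have h := isPreconnected_closed_iff.1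
    (isPreconnected_connectedComponentIn (F := ⋃₀ 𝒮) (x := p)) S (⋃₀ (𝒮 \ {S})) (hcl S hS)
    (by
      rw [Set.sUnion_eq_biUnion]
      exact (hfin.subset Set.sdiff_subset).isClosed_biUnion fun T hT => hcl T hT.1)
  intro q hq
  obtain ⟨T, hT, hqT⟩ := connectedComponentIn_subset _ _ hq
  by_contra hqS
  have hTS : T ∈ 𝒮 \ {S} := ⟨hT, fun h => hqS (h ▸ hqT)⟩
  obtain ⟨r, -, hrS, U, hU, hrU⟩ := h (fun r hr => by
      obtain ⟨U, hU, hrU⟩ := connectedComponentIn_subset _ _ hr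
      by_cases hUS : U = S
      · exact Or.inl (hUS ▸ hrU)
      · exact Or.inr ⟨U, ⟨hU, hUS⟩, hrU⟩)
    ⟨p, mem_connectedComponentIn hpN, hp⟩ ⟨q, hq, T, hTS, hqT⟩
  exact hU.2 (hdisj S hS U hU.1 ⟨r, hrS, hrU⟩).symm

/-- `N` is the disjoint union of the path `S₀` and of the finitely many cycles in `𝒞`. -/
structure Decomposition (K N S₀ : Set E) (𝒞 : Set (Set E)) : Prop where
  path : IsEdgePath K S₀
  cycle : ∀ S ∈ 𝒞, IsEdgeCycle K S
  finite : 𝒞.Finite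
  cover : N = ⋃₀ insert S₀ 𝒞
  disjoint : ∀ S ∈ insert S₀ 𝒞, ∀ T ∈ insert S₀ 𝒞, (S ∩ T).Nonempty → S = T
  closed : ∀ S ∈ insert S₀ 𝒞, IsClosed S
  preconnected : ∀ S ∈ insert S₀ 𝒞, IsPreconnected S

theorem Decomposition.exists_component_iff {K N S₀ : Set E} {𝒞 : Set (Set E)}
    (h : Decomposition K N S₀ 𝒞) {S : Set E} :
    (∃ p ∈ N, S = connectedComponentIn N p) ↔ S = S₀ ∨ S ∈ 𝒞 := by
  have key : ∀ S ∈ insert S₀ 𝒞, ∀ p ∈ S, connectedComponentIn N p = S := fun S hS p hp => by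
    rw [h.cover]
    exact connectedComponentIn_eq_of_mem (h.finite.insert S₀) h.closed h.preconnected h.disjoint
      hS hp
  constructor
  · rintro ⟨p, hp, rfl⟩
    rw [h.cover] at hp
    obtain ⟨T, hT, hp⟩ := hp
    rw [key T hT p hp]
    exact hT
  · intro hS
    have hS : S ∈ insert S₀ 𝒞 := hS
    obtain ⟨p, hp⟩ : S.Nonempty := by
      rcases hS with rfl | hS
      · exact h.path.nonempty
      · exact (h.cycle S hS).nonempty
    exact ⟨p, by rw [h.cover]; exact ⟨S, hS, hp⟩, (key S hS p hp).symm⟩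

theorem Decomposition.notMem {K N S₀ : Set E} {𝒞 : Set (Set E)} (h : Decomposition K N S₀ 𝒞) :
    S₀ ∉ 𝒞 := fun hS => h.path.not_isBounded (h.cycle _ hS).isBounded

/-- If a set meets the path in an odd and the cycles in an even number of points, then it meets
`N` in an odd number of points. -/
theorem Decomposition.odd_ncard_inter {K N S₀ : Set E} {𝒞 : Set (Set E)}
    (h : Decomposition K N S₀ 𝒞) {H : Set E} (h0 : (S₀ ∩ H).Finite) (h0' : Odd (S₀ ∩ H).ncard)
    (h1 : ∀ S ∈ 𝒞, (S ∩ H).Finite ∧ Even (S ∩ H).ncard) :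
    (N ∩ H).Finite ∧ Odd (N ∩ H).ncard := by
  have key : (⋃₀ 𝒞 ∩ H).Finite ∧ Even (⋃₀ 𝒞 ∩ H).ncard := by
    refine Set.Finite.induction_on_subset (motive := fun 𝒟 _ =>
      (⋃₀ 𝒟 ∩ H).Finite ∧ Even (⋃₀ 𝒟 ∩ H).ncard) 𝒞 h.finite (by simp) ?_
    intro S 𝒟 hS h𝒟 hS𝒟 ih
    rw [Set.sUnion_insert, Set.union_inter_distrib_right, Set.ncard_union_eq _ (h1 S hS).1 ih.1]
    · exact ⟨(h1 S hS).1.union ih.1, (h1 S hS).2.add ih.2⟩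
    · rw [Set.disjoint_left]
      rintro p ⟨hp, -⟩ ⟨⟨T, hT, hpT⟩, -⟩
      have := h.disjoint S (Or.inr hS) T (Or.inr (h𝒟 hT)) ⟨p, hp, hpT⟩
      exact hS𝒟 (this ▸ hT)
  rw [h.cover, Set.sUnion_insert, Set.union_inter_distrib_right, Set.ncard_union_eq _ h0 key.1]
  · exact ⟨h0.union key.1, h0'.add_even key.2⟩
  · rw [Set.disjoint_left]
    rintro p ⟨hp, -⟩ ⟨⟨T, hT, hpT⟩, -⟩
    have := h.disjoint S₀ (Or.inl rfl) T (Or.inr hT) ⟨p, hp, hpT⟩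
    exact h.notMem (this ▸ hT)

end Components

/-! ### Decomposition of N into one path and finitely many cycles -/

section PairedDecomposition

open PairedSystem

variable {L E W : Type*} [DecidableEq L] [Fintype L] [NormedAddCommGroup E] [NormedSpace ℝ E]
  [FiniteDimensional ℝ E] [NormedAddCommGroup W] [NormedSpace ℝ W]
  {M : PairedSystem L E W}

/-- The path that starts with the ray of `xm` ends with another ray, necessarily that of `xp`. All
other orbits are free of rays and therefore cycles. -/
theorem decomposition_of_two_rays (hM : M.Regular) {xm xp : M.Dart}
    (hne : xp ≠ xm) (hfix : ∀ y : M.Dart, y.opp = y ↔ y = xp ∨ y = xm) :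
    Linked Dart.flip Dart.opp xm xp ∧
    (∀ x : M.Dart, ¬ Linked Dart.flip Dart.opp xm x →
      ∀ y : M.Dart, Linked Dart.flip Dart.opp x y → y.opp ≠ y) ∧
    Decomposition M.poly M.full xm.orbit
      {S | ∃ x : M.Dart, ¬ Linked Dart.flip Dart.opp xm x ∧ x.orbit = S} := by
  have hsymm : ∀ {x y : M.Dart}, Linked Dart.flip Dart.opp x y → Linked Dart.flip Dart.opp y x :=
    fun h => h.symm Dart.flip_flip (Dart.opp_opp hM)
  obtain ⟨hpath, y, hy, hy1, hy2⟩ := Dart.isEdgePath_orbit hM ((hfix xm).2 (Or.inr rfl))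
  obtain rfl : y = xp := ((hfix y).1 hy2).resolve_right hy1
  have hcyc : ∀ x : M.Dart, ¬ Linked Dart.flip Dart.opp xm x →
      ∀ z : M.Dart, Linked Dart.flip Dart.opp x z → z.opp ≠ z := by
    intro x hx z hz hzo
    rcases (hfix z).1 hzo with rfl | rfl
    · exact hx (hy.trans (hsymm hz))
    · exact hx (hsymm hz)
  have hform : ∀ S ∈ insert xm.orbit
      {S | ∃ x : M.Dart, ¬ Linked Dart.flip Dart.opp xm x ∧ x.orbit = S},
      ∃ x : M.Dart, x.orbit = S := by
    rintro S (rfl | ⟨x, -, rfl⟩)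
    · exact ⟨xm, rfl⟩
    · exact ⟨x, rfl⟩
  refine ⟨hy, hcyc, hpath, ?_, ?_, ?_, ?_, ?_, ?_⟩
  · rintro S ⟨x, hx, rfl⟩
    exact Dart.isEdgeCycle_orbit hM (hcyc x hx)
  · refine (Set.finite_range (Dart.orbit : M.Dart → Set E)).subset ?_
    rintro S ⟨x, -, rfl⟩
    exact ⟨x, rfl⟩
  · rw [Dart.full_eq_iUnion_orbit hM]
    ext p
    rw [Set.mem_iUnion, Set.mem_sUnion]
    constructor
    · rintro ⟨x, hx⟩
      by_cases hl : Linked Dart.flip Dart.opp xm x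
      · exact ⟨_, Or.inl rfl, by rwa [Dart.orbit_eq hM hl]⟩
      · exact ⟨_, Or.inr ⟨x, hl, rfl⟩, hx⟩
    · rintro ⟨S, hS, hp⟩
      obtain ⟨x, rfl⟩ := hform S hS
      exact ⟨x, hp⟩
  · rintro S hS T hT ⟨p, hpS, hpT⟩
    obtain ⟨x, rfl⟩ := hform S hS
    obtain ⟨y, rfl⟩ := hform T hT
    exact Dart.orbit_eq hM (Dart.linked_of_mem_orbit hM hpS hpT)
  · intro S hS
    obtain ⟨x, rfl⟩ := hform S hS
    exact x.isClosed_orbit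
  · intro S hS
    obtain ⟨x, rfl⟩ := hform S hS
    exact Dart.isPreconnected_orbit hM x

end PairedDecomposition

section GameDecomposition

variable {m n : ℕ} {A C : Matrix (Fin m) (Fin n) ℝ} {β : Fin n → ℝ}

theorem exists_argmax (hm : 0 < m) (A : Matrix (Fin m) (Fin n) ℝ) (j : Fin n) :
    ∃ i, ∀ k, A k j ≤ A i j := by
  have : Nonempty (Fin m) := ⟨⟨0, hm⟩⟩
  exact Finite.exists_max fun k => A k j

theorem gap_of_eq_zero (α : Fin m → ℝ) {u : Pt m n} (hu : u.2.1 = 0) : gap α u = u.2.2.1 := by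
  simp [gap, hu]

theorem exists_decomposition_of_ne (hm : 0 < m) (hn : 0 < n) (hP : NondegP A)
    (hQ : NondegQ' C β) {js je : Fin n} (hs : ∀ j, j ≠ js → β js < β j)
    (he : ∀ j, j ≠ je → β j < β je) (hβ : ∃ j j', β j ≠ β j') :
    ∃ S₀ 𝒞, Decomposition (polyP A ×ˢ polyQ' C β) (fullyLabeled A C β) S₀ 𝒞 ∧
      ∀ α : Fin m → ℝ, (∃ p ∈ S₀, p ∈ hyperplane m n α) ∧
        (NondegQ (payoff C β α) →
          (S₀ ∩ hyperplane m n α).Finite ∧ Odd (S₀ ∩ hyperplane m n α).ncard ∧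
          ∀ S ∈ 𝒞, (S ∩ hyperplane m n α).Finite ∧ Even (S ∩ hyperplane m n α).ncard) := by
  have hM := regular_gameSystem hm hn hP hQ hβ
  obtain ⟨ip, hip⟩ := exists_argmax hm A je
  obtain ⟨im, him⟩ := exists_argmax hm A js
  obtain ⟨xp, hp, hpc, up, hpr, hup, hup'⟩ := exists_ray_dart hM hip (ε := 1) one_ne_zero
    (by simpa using he)
  obtain ⟨xm, hmo, hmc, um, hmr, hum, hum'⟩ := exists_ray_dart hM him (ε := -1)
    (neg_ne_zero.2 one_ne_zero) (by simpa using hs)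
  have hjne : je ≠ js := by
    rintro rfl
    have hall : ∀ j, j = je := fun j => by
      by_contra hj
      exact lt_asymm (hs j hj) (he j hj)
    obtain ⟨j, j', hj⟩ := hβ
    exact hj (by rw [hall j, hall j'])
  have hne : xp ≠ xm := by
    rintro rfl
    rw [hpc] at hmc
    have := congrFun hmc (Sum.inr je)
    simp [rayLabel, hjne] at this
  have hfix : ∀ y : (gameSystem A C β).Dart, y.opp = y ↔ y = xp ∨ y = xm := by
    intro y
    constructor
    · intro hy
      obtain ⟨u, hu, hψ, hye⟩ := PairedSystem.Dart.edge_eq_ray hM hy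
      obtain ⟨-, -, hu3, hc⟩ := ray_direction hu hψ hye.symm.le
      rcases lt_or_gt_of_ne hu3 with h0 | h0
      · right
        have := hc im js hP him fun k hk => mul_lt_mul_of_neg_right (hs k hk) h0
        rw [← hmc] at this
        rcases PairedSystem.Dart.eq_or_eq_opp hM this with h | h
        · exact h
        · rw [h, hmo]
      · left
        have := hc ip je hP hip fun k hk => mul_lt_mul_of_pos_right (he k hk) h0
        rw [← hpc] at this
        rcases PairedSystem.Dart.eq_or_eq_opp hM this with h | h
        · exact h
        · rw [h, hp]
    · rintro (rfl | rfl)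
      · exact hp
      · exact hmo
  obtain ⟨hl, hcyc, hdec⟩ := decomposition_of_two_rays hM hne hfix
  rw [poly_gameSystem, full_gameSystem] at hdec
  refine ⟨_, _, hdec, fun α => ?_⟩
  have hgp : 0 < gap α up := by rw [gap_of_eq_zero α hup]; linarith
  have hgm : gap α um < 0 := by rw [gap_of_eq_zero α hum]; linarith
  refine ⟨PairedSystem.Dart.exists_zero_mem_orbit hM (gap α) hl hmr hgm hpr hgp, fun hQα => ?_⟩
  have hv := gap_vertex_ne_zero hm hn hP hQ hβ hQα
  refine ⟨(PairedSystem.Dart.ncard_orbit_inter hM hv xm).1,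
    PairedSystem.Dart.odd_ncard_orbit_inter hM hv hne hl hfix hmr hgm hpr hgp, ?_⟩
  rintro S ⟨x, hx, rfl⟩
  exact ⟨(PairedSystem.Dart.ncard_orbit_inter hM hv x).1,
    PairedSystem.Dart.even_ncard_orbit_inter hM hv (hcyc x hx)⟩

/-- With a single column `y` is constant and `x` is the unique best reply, so only λ is free. -/
theorem fullyLabeled_subset_line (hP : NondegP A) {j : Fin n} (hj : ∀ k, k = j) {i : Fin m}
    (hi : ∀ k, A k j ≤ A i j) :
    fullyLabeled A C β ⊆ line (rayPoint A C β i j 0) ((0, 0), (0, 1, β j)) := by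
  rintro p ⟨⟨hpP, hpQ⟩, hlab⟩
  have hlab' : ∀ l, l ∈ labelP A p.1 ∨ l ∈ labelQ' C β p.2 := fun l =>
    (Set.eq_univ_iff_forall.1 hlab l)
  have hy : p.1.1 = Pi.single j 1 :=
    eq_single_of_mem_stdSimplex hpP.1 fun k hk => absurd (hj k) hk
  have hA : ∀ k, (A *ᵥ p.1.1) k = A k j := fun k => by rw [hy]; simp
  have hsupp : ∀ k, p.2.1 k ≠ 0 → A k j = p.1.2 := by
    intro k hk
    rw [← hA]
    exact (hlab' (Sum.inl k)).resolve_right hk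
  obtain ⟨i₀, hi₀⟩ := exists_pos_of_mem_stdSimplex hpQ.1
  have hiq : A i j = p.1.2 := by
    refine le_antisymm ?_ ?_
    · rw [← hA]; exact hpP.2 i
    · rw [← hsupp i₀ hi₀.ne']; exact hi i₀
  have hx : p.2.1 = Pi.single i 1 := by
    refine eq_single_of_mem_stdSimplex hpQ.1 fun k hk => ?_
    by_contra h0
    exact hk (argmax_unique hP hi ((hsupp k h0).trans hiq.symm))
  have hπ : (p.2.1 ᵥ* C) j + β j * p.2.2.1 = p.2.2.2 := by
    refine (hlab' (Sum.inr j)).resolve_left fun h => ?_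
    have h : p.1.1 j = 0 := h
    rw [hy] at h
    simp at h
  rw [hx] at hπ
  simp only [Matrix.single_one_vecMul, Matrix.row_apply] at hπ
  refine ⟨p.2.2.1, Prod.ext (Prod.ext ?_ ?_) (Prod.ext ?_ (Prod.ext ?_ ?_))⟩
  · simp [rayPoint, hy]
  · simp [rayPoint, hiq]
  · simp [rayPoint, hx]
  · simp [rayPoint]
  · simp [rayPoint, ← hπ, mul_comm]

theorem exists_decomposition_of_subsingleton (hm : 0 < m) (hP : NondegP A) {j : Fin n}
    (hj : ∀ k, k = j) :
    ∃ S₀ 𝒞, Decomposition (polyP A ×ˢ polyQ' C β) (fullyLabeled A C β) S₀ 𝒞 ∧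
      ∀ α : Fin m → ℝ, (∃ p ∈ S₀, p ∈ hyperplane m n α) ∧
        (NondegQ (payoff C β α) →
          (S₀ ∩ hyperplane m n α).Finite ∧ Odd (S₀ ∩ hyperplane m n α).ncard ∧
          ∀ S ∈ 𝒞, (S ∩ hyperplane m n α).Finite ∧ Even (S ∩ hyperplane m n α).ncard) := by
  obtain ⟨i, hi⟩ := exists_argmax hm A j
  set p₀ := rayPoint A C β i j 0
  set d : Pt m n := ((0, 0), (0, 1, β j))
  have hd : d ≠ 0 := by
    intro h
    have : d.2.2.1 = 0 := by rw [h]; rfl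
    exact one_ne_zero this
  have hpt : ∀ t : ℝ, p₀ + t • d = rayPoint A C β i j t := by
    intro t
    refine Prod.ext (Prod.ext ?_ ?_) (Prod.ext ?_ (Prod.ext ?_ ?_)) <;>
      simp [p₀, d, rayPoint, mul_comm]
  have hsub : line p₀ d ⊆ (gameSystem A C β).face (rayLabel i j) := by
    rintro _ ⟨t, rfl⟩
    rw [hpt]
    exact rayPoint_mem_face hi fun k => by rw [hj k]
  have hface : (gameSystem A C β).face (rayLabel i j) ⊆ fullyLabeled A C β := by
    rw [← full_gameSystem, PairedSystem.full_eq_iUnion]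
    exact Set.subset_iUnion (gameSystem A C β).face _
  have hfull := fullyLabeled_subset_line (C := C) (β := β) hP hj hi
  have e1 : fullyLabeled A C β = line p₀ d := hfull.antisymm (hsub.trans hface)
  have e2 : (gameSystem A C β).face (rayLabel i j) = line p₀ d :=
    (hface.trans hfull).antisymm hsub
  have hedge : IsEdge (polyP A ×ˢ polyQ' C β) (line p₀ d) := by
    rw [← poly_gameSystem, ← e2]
    refine ⟨PairedSystem.isExtreme_face _ _, PairedSystem.convex_face _ _, ?_⟩
    have : vectorSpan ℝ (line p₀ d) = ℝ ∙ d := by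
      refine le_antisymm (Submodule.span_le.2 ?_) ((Submodule.span_singleton_le_iff_mem _ _).2 ?_)
      · rintro _ ⟨_, ⟨s, rfl⟩, _, ⟨t, rfl⟩, rfl⟩
        simp only [vsub_eq_sub, add_sub_add_left_eq_sub, SetLike.mem_coe, ← sub_smul]
        exact Submodule.mem_span_singleton.2 ⟨_, rfl⟩
      · have := vsub_mem_vectorSpan ℝ (s := line p₀ d) (p₁ := p₀ + d) (p₂ := p₀) ⟨1, by simp⟩
          ⟨0, by simp⟩
        simpa using this
    rw [e2, this, finrank_span_singleton hd]
  have hclosed : IsClosed (line p₀ d) := by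
    have : line p₀ d = {p | p - p₀ ∈ (ℝ ∙ d)} := by
      ext p
      simp only [line, Set.mem_ofPred_eq, Submodule.mem_span_singleton]
      exact ⟨fun ⟨t, ht⟩ => ⟨t, by rw [ht]; simp⟩, fun ⟨t, ht⟩ => ⟨t, by rw [ht]; simp⟩⟩
    rw [this]
    exact (Submodule.closed_of_finiteDimensional (ℝ ∙ d)).preimage (by fun_prop)
  have hpre : IsPreconnected (line p₀ d) := e2 ▸ (PairedSystem.convex_face _ _).isPreconnected
  refine ⟨line p₀ d, ∅, ⟨Or.inr ⟨p₀, d, hedge, rfl⟩, by simp, Set.finite_empty, by simpa using e1,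
    by simp, by simpa using hclosed, by simpa using hpre⟩, fun α => ?_⟩
  have hiff : ∀ t : ℝ, p₀ + t • d ∈ hyperplane m n α ↔ t = α i := by
    intro t
    rw [hpt]
    simp [hyperplane, rayPoint, Pi.single_apply, sub_eq_zero]
  have hinter : line p₀ d ∩ hyperplane m n α = {p₀ + α i • d} := by
    ext p
    constructor
    · rintro ⟨⟨t, rfl⟩, h⟩
      rw [(hiff t).1 h]
      rfl
    · rintro rfl
      exact ⟨⟨_, rfl⟩, (hiff _).2 rfl⟩
  refine ⟨⟨p₀ + α i • d, ⟨_, rfl⟩, (hiff _).2 rfl⟩, fun _ => ?_⟩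
  rw [hinter, Set.ncard_singleton]
  exact ⟨Set.finite_singleton _, odd_one, by simp⟩

theorem exists_decomposition (hm : 0 < m) (hn : 0 < n) (hP : NondegP A)
    (hQ : NondegQ' C β) (hs : ∃ js, ∀ j, j ≠ js → β js < β j)
    (he : ∃ je, ∀ j, j ≠ je → β j < β je) :
    ∃ S₀ 𝒞, Decomposition (polyP A ×ˢ polyQ' C β) (fullyLabeled A C β) S₀ 𝒞 ∧
      ∀ α : Fin m → ℝ, (∃ p ∈ S₀, p ∈ hyperplane m n α) ∧
        (NondegQ (payoff C β α) →
          (S₀ ∩ hyperplane m n α).Finite ∧ Odd (S₀ ∩ hyperplane m n α).ncard ∧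
          ∀ S ∈ 𝒞, (S ∩ hyperplane m n α).Finite ∧ Even (S ∩ hyperplane m n α).ncard) := by
  obtain ⟨js, hs⟩ := hs
  obtain ⟨je, he⟩ := he
  by_cases hβ : ∃ j j', β j ≠ β j'
  · exact exists_decomposition_of_ne hm hn hP hQ hs he hβ
  -- A constant `β` has a unique minimizer only if there is a single column.
  · push Not at hβ
    refine exists_decomposition_of_subsingleton hm hP (j := js) fun k => ?_
    by_contra hk
    exact (hs k hk).ne (hβ _ _)

end GameDecomposition

/-! ### Equilibria as fully-labeled points on the hyperplane -/

section Nash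

variable {m n : ℕ} {A B C : Matrix (Fin m) (Fin n) ℝ} {β : Fin n → ℝ}

theorem dotProduct_le_of_mem_stdSimplex {ι : Type*} [Fintype ι] {x v : ι → ℝ} {r : ℝ}
    (hx : x ∈ stdSimplex ℝ ι) (h : ∀ i, v i ≤ r) : x ⬝ᵥ v ≤ r := by
  calc x ⬝ᵥ v ≤ ∑ i, x i * r := Finset.sum_le_sum fun i _ => mul_le_mul_of_nonneg_left (h i) (hx.1 i)
    _ = r := by rw [← Finset.sum_mul, hx.2, one_mul]

theorem dotProduct_eq_of_mem_stdSimplex {ι : Type*} [Fintype ι] {x v : ι → ℝ} {r : ℝ}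
    (hx : x ∈ stdSimplex ℝ ι) (h : ∀ i, v i = r ∨ x i = 0) : x ⬝ᵥ v = r := by
  calc x ⬝ᵥ v = ∑ i, x i * r := Finset.sum_congr rfl fun i _ => by
        rcases h i with h | h <;> simp [h]
    _ = r := by rw [← Finset.sum_mul, hx.2, one_mul]

theorem eq_or_eq_zero_of_dotProduct_eq {ι : Type*} [Fintype ι] {x v : ι → ℝ} {r : ℝ}
    (hx : x ∈ stdSimplex ℝ ι) (h : ∀ i, v i ≤ r) (he : x ⬝ᵥ v = r) (i : ι) :
    v i = r ∨ x i = 0 := by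
  have h1 : ∑ i, x i * (r - v i) = 0 := by
    simp only [mul_sub, Finset.sum_sub_distrib, ← Finset.sum_mul, hx.2, one_mul]
    rw [sub_eq_zero]
    exact he.symm
  rw [Finset.sum_eq_zero_iff_of_nonneg fun i _ => mul_nonneg (hx.1 i) (sub_nonneg.2 (h i))] at h1
  rcases mul_eq_zero.1 (h1 i (Finset.mem_univ i)) with h2 | h2
  · exact Or.inr h2
  · exact Or.inl (sub_eq_zero.1 h2).symm

theorem dotProduct_mulVec_comm (B : Matrix (Fin m) (Fin n) ℝ) (x : Fin m → ℝ) (y : Fin n → ℝ) :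
    x ⬝ᵥ (B *ᵥ y) = y ⬝ᵥ (x ᵥ* B) := by
  rw [Matrix.dotProduct_mulVec, dotProduct_comm]

/-- Complementary slackness: every pure strategy is unplayed or attains the bound, so π₁ and π₂ are
the actual payoffs. On H_α the inequalities of Q' become those of Q for G(α). -/
theorem payoffs_of_mem {α : Fin m → ℝ} {p : Pt m n} (hp : p ∈ fullyLabeled A C β)
    (hα : p ∈ hyperplane m n α) :
    (p.2.1, p.2.2.2) ∈ polyQ (payoff C β α) ∧ p.2.2.1 = ∑ i, α i * p.2.1 i ∧
      p.2.1 ⬝ᵥ (A *ᵥ p.1.1) = p.1.2 ∧ p.2.1 ⬝ᵥ (payoff C β α *ᵥ p.1.1) = p.2.2.2 := by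
  obtain ⟨⟨hP, hQ⟩, hlab⟩ := hp
  have hl : p.2.2.1 = ∑ i, α i * p.2.1 i := sub_eq_zero.1 hα
  have hlab' : ∀ l, l ∈ labelP A p.1 ∨ l ∈ labelQ' C β p.2 := Set.eq_univ_iff_forall.1 hlab
  refine ⟨(polyQ_payoff_iff hl).2 hQ, hl, ?_, ?_⟩
  · exact dotProduct_eq_of_mem_stdSimplex hQ.1 fun i => hlab' (Sum.inl i)
  · rw [dotProduct_mulVec_comm]
    refine dotProduct_eq_of_mem_stdSimplex hP.1 fun j => (hlab' (Sum.inr j)).symm.imp ?_ id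
    intro h
    rw [vecMul_payoff, ← hl]
    exact h

theorem isNash_of_mem {α : Fin m → ℝ} {p : Pt m n} (hp : p ∈ fullyLabeled A C β)
    (hα : p ∈ hyperplane m n α) : IsNash A (payoff C β α) p.2.1 p.1.1 := by
  obtain ⟨hQ, -, h1, h2⟩ := payoffs_of_mem hp hα
  refine ⟨hQ.1, hp.1.1.1, fun x' hx' => ?_, fun y' hy' => ?_⟩
  · rw [h1]
    exact dotProduct_le_of_mem_stdSimplex hx' hp.1.1.2
  · rw [h2, dotProduct_mulVec_comm]
    exact dotProduct_le_of_mem_stdSimplex hy' hQ.2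

theorem exists_mem_of_isNash {α : Fin m → ℝ} {x : Fin m → ℝ} {y : Fin n → ℝ}
    (h : IsNash A (payoff C β α) x y) :
    ∃ p ∈ fullyLabeled A C β ∩ hyperplane m n α, (p.2.1, p.1.1) = (x, y) := by
  obtain ⟨hx, hy, h1, h2⟩ := h
  have hA : ∀ i, (A *ᵥ y) i ≤ x ⬝ᵥ (A *ᵥ y) := fun i => by
    simpa using h1 _ (single_mem_stdSimplex ℝ i)
  have hB : ∀ j, (x ᵥ* payoff C β α) j ≤ x ⬝ᵥ (payoff C β α *ᵥ y) := fun j => by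
    have := h2 _ (single_mem_stdSimplex ℝ j)
    rw [dotProduct_mulVec_comm] at this
    simpa using this
  refine ⟨((y, x ⬝ᵥ (A *ᵥ y)), (x, ∑ i, α i * x i, x ⬝ᵥ (payoff C β α *ᵥ y))),
    ⟨⟨⟨⟨hy, hA⟩, (polyQ_payoff_iff rfl).1 ⟨hx, hB⟩⟩, ?_⟩, sub_self _⟩, rfl⟩
  refine Set.eq_univ_iff_forall.2 ?_
  rintro (i | j)
  · exact eq_or_eq_zero_of_dotProduct_eq hx hA rfl i
  · refine (eq_or_eq_zero_of_dotProduct_eq hy hB (dotProduct_mulVec_comm _ _ _).symm j).symm.imp id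
      fun h => ?_
    rw [vecMul_payoff] at h
    exact h

theorem nashSet_eq_image (α : Fin m → ℝ) :
    nashSet A (payoff C β α) =
      (fun p : Pt m n => (p.2.1, p.1.1)) '' (fullyLabeled A C β ∩ hyperplane m n α) := by
  ext ⟨x, y⟩
  constructor
  · exact fun h => exists_mem_of_isNash h
  · rintro ⟨p, hp, h⟩
    have := isNash_of_mem hp.1 hp.2
    obtain ⟨rfl, rfl⟩ := Prod.ext_iff.1 h
    exact this

/-- The profile determines λ through the equation of H_α, and π₁, π₂ as its payoffs. -/
theorem injOn_profile (α : Fin m → ℝ) :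
    Set.InjOn (fun p : Pt m n => (p.2.1, p.1.1)) (fullyLabeled A C β ∩ hyperplane m n α) := by
  rintro ⟨⟨y, r⟩, x, l, s⟩ hp ⟨⟨y', r'⟩, x', l', s'⟩ hq h
  obtain ⟨-, h1, h2, h3⟩ := payoffs_of_mem hp.1 hp.2
  obtain ⟨-, h1', h2', h3'⟩ := payoffs_of_mem hq.1 hq.2
  simp only [Prod.mk.injEq] at h h1 h2 h3 h1' h2' h3' ⊢
  obtain ⟨rfl, rfl⟩ := h
  exact ⟨⟨rfl, h2.symm.trans h2'⟩, rfl, h1.trans h1'.symm, h3.symm.trans h3'⟩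

end Nash

/-! ### Genericity: density of non-degenerate games and a generic direction β -/

section Generic

variable {m n : ℕ}

/-- Combinations of a constant function and of the rows `i ∈ I` of `B`, on the columns in `J`. -/
def rowCombination (B : Matrix (Fin m) (Fin n) ℝ) (I : Finset (Fin m)) (J : Finset (Fin n)) :
    (ℝ × (I → ℝ)) →ₗ[ℝ] (J → ℝ) where
  toFun c j := c.1 + ∑ i : I, c.2 i * B i j
  map_add' c d := by
    funext j
    simp only [Prod.fst_add, Prod.snd_add, Pi.add_apply, add_mul, Finset.sum_add_distrib]
    ring
  map_smul' a c := by
    funext j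
    simp only [Prod.smul_fst, Prod.smul_snd, Pi.smul_apply, smul_eq_mul, RingHom.id_apply, mul_add,
      Finset.mul_sum, mul_assoc]

/-- The vectors that agree on `J` with a combination of a constant and of the rows in `I`. -/
def rowSpan (B : Matrix (Fin m) (Fin n) ℝ) (I : Finset (Fin m)) (J : Finset (Fin n)) :
    Submodule ℝ (Fin n → ℝ) :=
  (LinearMap.range (rowCombination B I J)).comap (LinearMap.funLeft ℝ ℝ (Subtype.val : J → Fin n))

theorem mem_rowSpan_of_eq {B : Matrix (Fin m) (Fin n) ℝ} {I : Finset (Fin m)} {J : Finset (Fin n)}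
    {v : Fin n → ℝ} (a : ℝ) (c : Fin m → ℝ) (h : ∀ j ∈ J, v j = a + ∑ i ∈ I, c i * B i j) :
    v ∈ rowSpan B I J := by
  refine ⟨(a, fun i => c i), ?_⟩
  funext j
  rw [LinearMap.funLeft_apply, h j j.2]
  simp only [rowCombination, LinearMap.coe_mk, AddHom.coe_mk]
  rw [Finset.sum_coe_sort I fun i => c i * B i j]

theorem rowSpan_congr {B B' : Matrix (Fin m) (Fin n) ℝ} {I : Finset (Fin m)} (J : Finset (Fin n))
    (h : ∀ i ∈ I, B i = B' i) : rowSpan B I J = rowSpan B' I J := by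
  have : rowCombination B I J = rowCombination B' I J := by
    refine LinearMap.ext fun c => funext fun j => ?_
    simp [rowCombination, fun i : I => h i i.2]
  rw [rowSpan, rowSpan, this]

/-- The `I.card + 1` coefficients cannot produce all values on `J`. -/
theorem rowSpan_ne_top (B : Matrix (Fin m) (Fin n) ℝ) {I : Finset (Fin m)} {J : Finset (Fin n)}
    (h : I.card + 2 ≤ J.card) : rowSpan B I J ≠ ⊤ := by
  intro htop
  have hsurj : Function.Surjective (rowCombination B I J) := by
    intro w
    obtain ⟨v, rfl⟩ := LinearMap.funLeft_surjective_of_injective ℝ ℝ (Subtype.val : J → Fin n)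
      Subtype.val_injective w
    have : v ∈ rowSpan B I J := by rw [htop]; trivial
    exact this
  have := LinearMap.finrank_le_finrank_of_surjective hsurj
  simp only [Module.finrank_prod, Module.finrank_self, Module.finrank_fintype_fun_eq_card,
    Fintype.card_coe] at this
  omega

theorem dense_compl_of_ne_top {E : Type*} [NormedAddCommGroup E] [NormedSpace ℝ E]
    [FiniteDimensional ℝ E] {ι : Type*} [Finite ι] (V : ι → Submodule ℝ E) (h : ∀ i, V i ≠ ⊤) :
    Dense (⋂ i, ((V i : Set E))ᶜ) := by
  have : CompleteSpace E := FiniteDimensional.complete ℝ E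
  refine dense_iInter_of_isOpen (fun i => ?_) fun i => ?_
  · exact (Submodule.closed_of_finiteDimensional (V i)).isOpen_compl
  · rw [← interior_eq_empty_iff_dense_compl]
    by_contra hne
    exact h i ((V i).eq_top_of_nonempty_interior' (Set.nonempty_iff_ne_empty.2 hne))

theorem dense_generic (B : Matrix (Fin m) (Fin n) ℝ) :
    Dense {v : Fin n → ℝ | ∀ I J, I.card + 2 ≤ J.card → v ∉ rowSpan B I J} := by
  have := dense_compl_of_ne_top
    (fun s : {s : Finset (Fin m) × Finset (Fin n) // s.1.card + 2 ≤ s.2.card} =>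
      rowSpan B s.1.1 s.1.2) fun s => rowSpan_ne_top B s.2
  refine this.mono fun v hv I J h => ?_
  exact Set.mem_iInter.1 hv ⟨(I, J), h⟩

/-- A matrix whose rows are in general position. -/
def RowGeneric (B : Matrix (Fin m) (Fin n) ℝ) (k : ℕ) : Prop :=
  ∀ i : Fin m, i.val < k → ∀ I J, (∀ i' ∈ I, i' < i) → I.card + 2 ≤ J.card → B i ∉ rowSpan B I J

/-- The rows are perturbed one after the other inside their open sets, each avoiding finitely many
proper subspaces spanned with earlier rows. -/
theorem exists_rowGeneric (B : Matrix (Fin m) (Fin n) ℝ) (O : Fin m → Set (Fin n → ℝ))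
    (hO : ∀ i, IsOpen (O i)) (hB : ∀ i, B i ∈ O i) (k : ℕ) :
    ∃ B' : Matrix (Fin m) (Fin n) ℝ, (∀ i, B' i ∈ O i) ∧ RowGeneric B' k := by
  induction k with
  | zero => exact ⟨B, hB, fun i hi => absurd hi (by omega)⟩
  | succ k ih =>
    obtain ⟨B₁, h1, h2⟩ := ih
    by_cases hk : k < m
    · obtain ⟨v, hvO, hv⟩ := (dense_generic B₁).inter_open_nonempty (O ⟨k, hk⟩) (hO _) ⟨_, h1 _⟩
      refine ⟨B₁.updateRow ⟨k, hk⟩ v, fun i => ?_, fun i hi I J hI hJ => ?_⟩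
      · by_cases hik : i = ⟨k, hk⟩
        · subst hik; simpa only [Matrix.updateRow_self] using hvO
        · simpa only [Matrix.updateRow_ne hik] using h1 i
      -- Only rows before `i` enter the span, and `i` is at most `k`, so the new row `k` is not
      -- among them.
      · rw [rowSpan_congr (B' := B₁) J fun i' hi' => ?_]
        · by_cases hik : i = ⟨k, hk⟩
          · subst hik
            simpa only [Matrix.updateRow_self] using hv I J hJ
          · rw [Matrix.updateRow_ne hik]
            refine h2 i ?_ I J hI hJ
            have : i.val ≠ k := fun h => hik (Fin.ext h)
            omega
        · refine Matrix.updateRow_ne fun h => ?_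
          have h3 := hI i' hi'
          rw [h, Fin.lt_def] at h3
          simp only at h3
          omega
    · exact ⟨B₁, h1, fun i hi => h2 i (by omega)⟩

open Classical in
/-- The number of labels of a point `w` with support `I` and tight columns `J`. -/
theorem ncard_labels (x : Fin m → ℝ) (T : Fin n → Prop) :
    {l : Fin m ⊕ Fin n | Sum.elim (fun i => x i = 0) T l}.ncard =
      (m - (Finset.univ.filter fun i => x i ≠ 0).card) + (Finset.univ.filter T).card := by
  have : {l : Fin m ⊕ Fin n | Sum.elim (fun i => x i = 0) T l} =
      ((((Finset.univ.filter fun i => x i ≠ 0)ᶜ).disjSum (Finset.univ.filter T) :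
        Finset (Fin m ⊕ Fin n)) : Set (Fin m ⊕ Fin n)) := by
    ext (i | j) <;> simp
  rw [this, Set.ncard_coe_finset, Finset.card_disjSum, Finset.card_compl, Fintype.card_fin]

theorem vecMul_eq_sum_support {B : Matrix (Fin m) (Fin n) ℝ} (x : Fin m → ℝ) (j : Fin n) :
    (x ᵥ* B) j = ∑ i ∈ Finset.univ.filter (fun i => x i ≠ 0), x i * B i j := by
  change ∑ i, x i * B i j = _
  exact (Finset.sum_filter_of_ne (f := fun i => x i * B i j)
    fun i _ h => left_ne_zero_of_mul h).symm

/-- More than m labels mean more tight columns than played rows. Solving the tight equations for the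
last played row puts it in a span of earlier rows, with two more columns than rows. -/
theorem nondegQ_of_rowGeneric {B : Matrix (Fin m) (Fin n) ℝ} (h : RowGeneric B m) :
    NondegQ B := by
  classical
  rintro ⟨x, r⟩ ⟨hx, hr⟩
  by_contra! hlt
  have hc := ncard_labels x fun j => (x ᵥ* B) j = r
  change (labelQ B (x, r)).ncard = _ at hc
  set I := Finset.univ.filter fun i => x i ≠ 0 with hI
  set J := Finset.univ.filter fun j => (x ᵥ* B) j = r with hJ
  have hIm : I.card ≤ m := by simpa using Finset.card_le_univ I
  have hne : I.Nonempty := by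
    obtain ⟨i, hi⟩ := exists_pos_of_mem_stdSimplex hx
    exact ⟨i, by simpa [hI] using hi.ne'⟩
  set i := I.max' hne
  have hi : i ∈ I := I.max'_mem hne
  have hxi : x i ≠ 0 := by simpa [hI] using hi
  refine h i i.2 (I.erase i) J (fun i' hi' => ?_) ?_
    (mem_rowSpan_of_eq (r / x i) (fun k => -(x k / x i)) fun j hj => ?_)
  · exact lt_of_le_of_ne (I.le_max' i' (Finset.mem_of_mem_erase hi')) (Finset.ne_of_mem_erase hi')
  · rw [Finset.card_erase_of_mem hi]
    have := hne.card_pos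
    omega
  · have h1 : (x ᵥ* B) j = r := by simpa [hJ] using hj
    rw [vecMul_eq_sum_support, ← Finset.add_sum_erase _ _ hi] at h1
    have h2 : ∑ k ∈ I.erase i, -(x k / x i) * B k j =
        -(∑ k ∈ I.erase i, x k * B k j) / x i := by
      rw [neg_div, Finset.sum_div, ← Finset.sum_neg_distrib]
      exact Finset.sum_congr rfl fun k _ => by ring
    rw [h2]
    field_simp
    linarith

/-- For λ = 0 the point lies in Q. Otherwise the tight equations can be solved for `β` by dividing
by λ, which genericity forbids once there are more than m + 1 labels. -/
theorem nondegQ'_of_generic {B : Matrix (Fin m) (Fin n) ℝ} (hB : NondegQ B) {β : Fin n → ℝ}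
    (h : ∀ I J, I.card + 2 ≤ J.card → β ∉ rowSpan B I J) : NondegQ' B β := by
  classical
  rintro ⟨x, l, r⟩ ⟨hx, hr⟩
  by_cases hl : l = 0
  · subst hl
    simp only [mul_zero, add_zero] at hr
    have := hB (x, r) ⟨hx, hr⟩
    have h1 : labelQ' B β (x, 0, r) = labelQ B (x, r) := by simp [labelQ', labelQ]
    rw [h1]
    omega
  by_contra! hlt
  have hc := ncard_labels x fun j => (x ᵥ* B) j + β j * l = r
  change (labelQ' B β (x, l, r)).ncard = _ at hc
  set I := Finset.univ.filter fun i => x i ≠ 0 with hI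
  set J := Finset.univ.filter fun j => (x ᵥ* B) j + β j * l = r with hJ
  have hIm : I.card ≤ m := by simpa using Finset.card_le_univ I
  refine h I J (by omega) (mem_rowSpan_of_eq (r / l) (fun k => -(x k / l)) fun j hj => ?_)
  have h1 : (x ᵥ* B) j + β j * l = r := by simpa [hJ] using hj
  rw [vecMul_eq_sum_support] at h1
  have h2 : ∑ k ∈ I, -(x k / l) * B k j = -(∑ k ∈ I, x k * B k j) / l := by
    rw [neg_div, Finset.sum_div, ← Finset.sum_neg_distrib]
    exact Finset.sum_congr rfl fun k _ => by ring
  rw [h2]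
  field_simp
  linarith

theorem injective_of_generic {B : Matrix (Fin m) (Fin n) ℝ} {β : Fin n → ℝ}
    (h : ∀ I J, I.card + 2 ≤ J.card → β ∉ rowSpan B I J) : Function.Injective β := by
  intro j j' hj
  by_contra hne
  refine h ∅ {j, j'} (by simp [Finset.card_pair hne])
    (mem_rowSpan_of_eq (β j) 0 fun k hk => ?_)
  rcases Finset.mem_insert.1 hk with rfl | hk
  · simp
  · rw [Finset.mem_singleton.1 hk]
    simp [hj]

theorem exists_generic_direction {B : Matrix (Fin m) (Fin n) ℝ} (hn : 0 < n) (hB : NondegQ B) :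
    ∃ β : Fin n → ℝ, NondegQ' B β ∧ (∃ js, ∀ j, j ≠ js → β js < β j) ∧
      ∃ je, ∀ j, j ≠ je → β j < β je := by
  obtain ⟨β, hβ⟩ := (dense_generic B).nonempty
  have hinj := injective_of_generic hβ
  have : Nonempty (Fin n) := ⟨⟨0, hn⟩⟩
  obtain ⟨js, hjs⟩ := Finite.exists_min β
  obtain ⟨je, hje⟩ := Finite.exists_max β
  exact ⟨β, nondegQ'_of_generic hB hβ,
    ⟨js, fun j hj => lt_of_le_of_ne (hjs j) fun h => hj (hinj h).symm⟩,
    ⟨je, fun j hj => lt_of_le_of_ne (hje j) fun h => hj (hinj h)⟩⟩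

theorem dense_nondegQ : Dense {B : Matrix (Fin m) (Fin n) ℝ | NondegQ B} := by
  intro B
  rw [mem_closure_iff_nhds_basis (by
    rw [show nhds B = Filter.pi fun i => nhds (B i) from nhds_pi]
    exact Filter.hasBasis_pi fun i => nhds_basis_opens (B i))]
  rintro ⟨s, O⟩ ⟨hs, hO⟩
  obtain ⟨B', h1, h2⟩ := exists_rowGeneric B (fun i => {v | i ∈ s → v ∈ O i})
    (fun i => by
      by_cases hi : i ∈ s
      · simpa [hi] using (hO i hi).2
      · simp [hi])
    (fun i hi => (hO i hi).1) m
  exact ⟨B', nondegQ_of_rowGeneric h2, fun i hi => h1 i hi⟩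

theorem nondegP_iff_transpose {A : Matrix (Fin m) (Fin n) ℝ} : NondegP A ↔ NondegQ Aᵀ := by
  have h1 : polyP A = polyQ Aᵀ := by
    simp only [polyP, polyQ, Matrix.vecMul_transpose]
  have h2 : ∀ v, (labelP A v).ncard = (labelQ Aᵀ v).ncard := by
    intro v
    rw [← Set.ncard_image_of_injective (labelP A v) (Sum.swap_leftInverse.injective)]
    congr 1
    ext (j | i)
    · simp [labelP, labelQ]
    · simp [labelP, labelQ, Matrix.vecMul_transpose]
  simp only [NondegP, NondegQ, h1, h2]

theorem dense_nondegP : Dense {A : Matrix (Fin m) (Fin n) ℝ | NondegP A} := by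
  have h := (dense_nondegQ (m := n) (n := m)).preimage
    (f := (Matrix.transpose : Matrix (Fin m) (Fin n) ℝ → Matrix (Fin n) (Fin m) ℝ))
    (Homeomorph.isOpenMap
      { toFun := Matrix.transpose, invFun := Matrix.transpose,
        left_inv := Matrix.transpose_transpose, right_inv := Matrix.transpose_transpose,
        continuous_toFun := continuous_id.matrix_transpose,
        continuous_invFun := continuous_id.matrix_transpose })
  simpa only [nondegP_iff_transpose] using! h

end Generic

/-! ### Oddness and existence for arbitrary games -/

section Existence

variable {m n : ℕ}

/-- It is the projection of a closed set along the compact product of the simplices. -/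
theorem isClosed_setOf_exists_isNash :
    IsClosed {g : Matrix (Fin m) (Fin n) ℝ × Matrix (Fin m) (Fin n) ℝ |
      ∃ x y, IsNash g.1 g.2 x y} := by
  have hcl : IsClosed {s : (Matrix (Fin m) (Fin n) ℝ × Matrix (Fin m) (Fin n) ℝ) ×
      (stdSimplex ℝ (Fin m) × stdSimplex ℝ (Fin n)) | IsNash s.1.1 s.1.2 s.2.1.1 s.2.2.1} := by
    simp only [IsNash, Subtype.coe_prop, true_and, Set.ofPred_and, Set.ofPred_forall]
    refine IsClosed.inter (isClosed_iInter fun x' => isClosed_iInter fun _ => ?_)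
      (isClosed_iInter fun y' => isClosed_iInter fun _ => ?_)
    · exact isClosed_le (by fun_prop) (by fun_prop)
    · exact isClosed_le (by fun_prop) (by fun_prop)
  have : CompactSpace (stdSimplex ℝ (Fin m)) := isCompact_iff_compactSpace.1 (isCompact_stdSimplex ℝ _)
  have : CompactSpace (stdSimplex ℝ (Fin n)) := isCompact_iff_compactSpace.1 (isCompact_stdSimplex ℝ _)
  convert isClosedMap_fst_of_compactSpace _ hcl using 1
  ext ⟨A, B⟩
  constructor
  · rintro ⟨x, y, h⟩
    exact ⟨((A, B), (⟨x, h.1⟩, ⟨y, h.2.1⟩)), h, rfl⟩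
  · rintro ⟨⟨_, x, y⟩, h, rfl⟩
    exact ⟨x, y, h⟩

theorem payoff_zero (B : Matrix (Fin m) (Fin n) ℝ) (β : Fin n → ℝ) : payoff B β 0 = B := by
  simp [payoff]

theorem finite_odd_nashSet (hm : 0 < m) (hn : 0 < n) {A B : Matrix (Fin m) (Fin n) ℝ}
    (h : NondegGame A B) : (nashSet A B).Finite ∧ Odd (nashSet A B).ncard := by
  obtain ⟨β, hQ', hs, he⟩ := exists_generic_direction hn h.2
  obtain ⟨S₀, 𝒞, hdec, hα⟩ := exists_decomposition hm hn h.1 hQ' hs he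
  obtain ⟨h1, h2, h3⟩ := (hα 0).2 (by rw [payoff_zero]; exact h.2)
  have h4 := hdec.odd_ncard_inter h1 h2 h3
  have h5 := nashSet_eq_image (A := A) (C := B) (β := β) 0
  rw [payoff_zero] at h5
  rw [h5, (injOn_profile 0).ncard_image]
  exact ⟨h4.1.image _, h4.2⟩

/-- Non-degenerate games are dense, and an odd number of equilibria is not zero; closedness carries
existence to the limit. -/
theorem exists_isNash (hm : 0 < m) (hn : 0 < n) (A B : Matrix (Fin m) (Fin n) ℝ) :
    ∃ x y, IsNash A B x y := by
  have hd := (dense_nondegP (m := m) (n := n)).prod (dense_nondegQ (m := m) (n := n))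
  have hsub : {A : Matrix (Fin m) (Fin n) ℝ | NondegP A} ×ˢ
      {B : Matrix (Fin m) (Fin n) ℝ | NondegQ B} ⊆ {g | ∃ x y, IsNash g.1 g.2 x y} := by
    rintro g hg
    have ho := (finite_odd_nashSet hm hn (A := g.1) (B := g.2) hg).2
    obtain ⟨⟨x, y⟩, hs⟩ := Set.nonempty_of_ncard_ne_zero ho.pos.ne'
    exact ⟨x, y, hs⟩
  have := isClosed_setOf_exists_isNash.closure_subset_iff.2 hsub (hd (A, B))
  exact this

end Existence

end BimatrixGame

end

/-! ### The theorem -/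

theorem mainTheorem10 (m n : ℕ) (hm : 0 < m) (hn : 0 < n) :
    (∀ (A C : Matrix (Fin m) (Fin n) ℝ) (β : Fin n → ℝ),
      BimatrixGame.NondegP A → BimatrixGame.NondegQ' C β →
      (∃ js, ∀ j, j ≠ js → β js < β j) → (∃ je, ∀ j, j ≠ je → β j < β je) →
      -- `N` consists of exactly one path and finitely many cycles
      (∃! S, BimatrixGame.IsFullyLabeledPath A C β S) ∧
      {S | BimatrixGame.IsFullyLabeledCycle A C β S}.Finite ∧
      (∀ S, BimatrixGame.IsComponent A C β S →
        BimatrixGame.IsFullyLabeledPath A C β S ∨ BimatrixGame.IsFullyLabeledCycle A C β S) ∧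
      -- the path contains a Nash equilibrium of every game `G(α)`
      (∀ S, BimatrixGame.IsFullyLabeledPath A C β S → ∀ α : Fin m → ℝ,
        ∃ p ∈ S ∩ BimatrixGame.hyperplane m n α,
          BimatrixGame.IsNash A (BimatrixGame.payoff C β α) p.2.1 p.1.1) ∧
      -- parity of the intersections with the hyperplane of a non-degenerate game `G(α)`
      (∀ α : Fin m → ℝ, BimatrixGame.NondegGame A (BimatrixGame.payoff C β α) →
        (∀ S, BimatrixGame.IsFullyLabeledPath A C β S →
          (S ∩ BimatrixGame.hyperplane m n α).Finite ∧
          Odd (S ∩ BimatrixGame.hyperplane m n α).ncard) ∧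
        (∀ S, BimatrixGame.IsFullyLabeledCycle A C β S →
          (S ∩ BimatrixGame.hyperplane m n α).Finite ∧
          Even (S ∩ BimatrixGame.hyperplane m n α).ncard))) ∧
    -- every bimatrix game has a Nash equilibrium
    (∀ A B : Matrix (Fin m) (Fin n) ℝ, ∃ x y, BimatrixGame.IsNash A B x y) ∧
    -- a non-degenerate bimatrix game has an odd number of Nash equilibria
    (∀ A B : Matrix (Fin m) (Fin n) ℝ, BimatrixGame.NondegGame A B →
      (BimatrixGame.nashSet A B).Finite ∧ Odd (BimatrixGame.nashSet A B).ncard) := by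
  refine ⟨fun A C β hP hQ hs he => ?_, BimatrixGame.exists_isNash hm hn,
    fun A B h => BimatrixGame.finite_odd_nashSet hm hn h⟩
  obtain ⟨S₀, 𝒞, hdec, hα⟩ := BimatrixGame.exists_decomposition hm hn hP hQ hs he
  have hcomp : ∀ S, BimatrixGame.IsComponent A C β S ↔ S = S₀ ∨ S ∈ 𝒞 := fun S =>
    hdec.exists_component_iff
  have hpath : ∀ S, BimatrixGame.IsFullyLabeledPath A C β S ↔ S = S₀ := by
    refine fun S => ⟨fun h => ((hcomp S).1 h.1).resolve_right fun hS => ?_, ?_⟩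
    · exact h.2.not_isBounded (hdec.cycle S hS).isBounded
    · rintro rfl
      exact ⟨(hcomp _).2 (Or.inl rfl), hdec.path⟩
  have hcycle : ∀ S, BimatrixGame.IsFullyLabeledCycle A C β S ↔ S ∈ 𝒞 := by
    refine fun S => ⟨fun h => ((hcomp S).1 h.1).resolve_left ?_, fun h =>
      ⟨(hcomp S).2 (Or.inr h), hdec.cycle S h⟩⟩
    rintro rfl
    exact hdec.path.not_isBounded h.2.isBounded
  refine ⟨⟨S₀, (hpath S₀).2 rfl, fun S hS => (hpath S).1 hS⟩, ?_, ?_, ?_, ?_⟩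
  · simp only [hcycle]
    exact hdec.finite
  · intro S hS
    rw [hpath, hcycle]
    exact (hcomp S).1 hS
  · intro S hS α
    obtain rfl := (hpath S).1 hS
    obtain ⟨p, hp, hpα⟩ := (hα α).1
    refine ⟨p, ⟨hp, hpα⟩, BimatrixGame.isNash_of_mem ?_ hpα⟩
    rw [hdec.cover]
    exact ⟨_, Or.inl rfl, hp⟩
  · intro α hG
    obtain ⟨h1, h2, h3⟩ := (hα α).2 hG.2
    refine ⟨fun S hS => ?_, fun S hS => h3 S ((hcycle S).1 hS)⟩
    obtain rfl := (hpath S).1 hS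
    exact ⟨h1, h2⟩
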